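/- **Theorem.** An alternating sign matrix (ASM) of order $n$ is an $n\times n$ matrix with entries in $\{0,1,-1\}$ such that the nonzero entries of each row and of each column alternate between $1$ and $-1$, beginning and ending with $1$. Let $\mathrm{ASM}(n)$ be the set of all ASMs of order $n$. For $A\in\mathrm{ASM}(n)$ let $\mu(A)$ be the number of $-1$'s in $A$, and let $f(A)$ and $\ell(A)$ be the column indices (in $\{1,\dots,n\}$) of the unique $1$ in the first row and of the unique $1$ in the last row of $A$. Put $$A_n(z,\rho,\tau)=\sum_{A\in\mathrm{ASM}(n)} z^{\mu(A)}\rho^{f(A)}\tau^{\ell(A)} .$$ Let $n\ge 2$, and let $q,\rho,\tau$ be elements of a field (for instance, three indeterminates in a field of rational functions, or complex numbers) with $q\ne 0$, $q\neq\pm1$, $1+\rho q\ne0$ and $\tau+q\neq 0$. Then $$A_n\bigl(2+q+q^{-1},\rho,\tau\bigr)=\left(\frac{(1+\rho q)(\tau+q)}{(1+q)^2}\right)^{n-1}\cdot\frac{\tau\rho\cdot\det\bigl(K^{\rho,\tau}_{i,j}(q)\bigr)_{1\le i,j\le n}}{(2-q-q^{-1})^{n(n-1)/2}},$$ where $$K^{\rho,\tau}_{i,j}(q)=\sum_{k=-n+1}^{n}(-1)^{k+1}\frac{q^k-q^{-k}}{q-q^{-1}}\binom{2j+k-3}{i-1}\left[\binom{n-2}{k+j-3}+\left(\frac{\rho+q}{1+\rho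 q}+\frac{1+\tau q}{\tau+q}\right)\binom{n-2}{k+j-2}+\frac{(\rho+q)(1+\tau q)}{(1+\rho q)(\tau+q)}\binom{n-2}{k+j-1}\right].$$ Here, for integers $a,b$, $\binom ab=\frac{a(a-1)\cdots(a-b+1)}{b!}$ if $b\ge0$, and $\binom ab=0$ if $b<0$. -/

import Mathlib

/-- The nonzero terms of the finite sequence `v` alternate between `1` and `-1`, and the first and
the last of them are both `1` (in particular there is a nonzero term). -/
structure IsAlternatingSign {n : ℕ} (v : Fin n → SignType) : Prop where
  first_eq_one : ∃ j, v j = 1 ∧ ∀ k, k < j → v k = 0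
  last_eq_one : ∃ j, v j = 1 ∧ ∀ k, j < k → v k = 0
  alternate : ∀ i j, i < j → v i ≠ 0 → v j ≠ 0 → (∀ k, i < k → k < j → v k = 0) → v j = -v i

/-- Alternating sign matrices: the entries are `0`, `1` or `-1` (the elements of `SignType`), and
the nonzero entries of each row and of each column alternate, beginning and ending with `1`. -/
structure IsASM {n : ℕ} (A : Matrix (Fin n) (Fin n) SignType) : Prop where
  row : ∀ i, IsAlternatingSign fun j => A i j
  col : ∀ j, IsAlternatingSign fun i => A i j

open Classical in
/-- The finite set of all `n × n` alternating sign matrices. -/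
noncomputable def ASM (n : ℕ) : Finset (Matrix (Fin n) (Fin n) SignType) :=
  Finset.univ.filter fun A => IsASM A

/-- The number of entries equal to `-1`. -/
def numNegOnes {n : ℕ} (A : Matrix (Fin n) (Fin n) SignType) : ℕ :=
  (Finset.univ.filter fun p : Fin n × Fin n => A p.1 p.2 = -1).card

/-- The column, counted from `1`, of the unique `1` in the first row of an alternating sign
matrix. -/
noncomputable def firstRowCol {n : ℕ} (A : Matrix (Fin n) (Fin n) SignType) : ℕ :=
  sInf {c : ℕ | ∃ i j : Fin n, (i : ℕ) + 1 = 1 ∧ (j : ℕ) + 1 = c ∧ A i j = 1}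

/-- The column, counted from `1`, of the unique `1` in the last row of an alternating sign
matrix. -/
noncomputable def lastRowCol {n : ℕ} (A : Matrix (Fin n) (Fin n) SignType) : ℕ :=
  sInf {c : ℕ | ∃ i j : Fin n, (i : ℕ) + 1 = n ∧ (j : ℕ) + 1 = c ∧ A i j = 1}

/-- The doubly refined generating function of the `n × n` alternating sign matrices. -/
noncomputable def asmGF {F : Type*} [Field F] (n : ℕ) (z ρ τ : F) : F :=
  ∑ A ∈ ASM n, z ^ numNegOnes A * ρ ^ firstRowCol A * τ ^ lastRowCol A

/-- The binomial coefficient `a (a - 1) ⋯ (a - b + 1) / b!` of integers, which is `0` for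
`b < 0`. -/
def intBinom (a b : ℤ) : ℤ :=
  if 0 ≤ b then Ring.choose a b.toNat else 0

/-- The entry in row `i` and column `j`, both counted from `1`, of the `n × n` matrix `K`. -/
noncomputable def kEntry {F : Type*} [Field F] (n : ℕ) (q ρ τ : F) (i j : ℤ) : F :=
  ∑ k ∈ Finset.Icc (-(n : ℤ) + 1) (n : ℤ),
    (-1) ^ (k + 1) * ((q ^ k - q ^ (-k)) / (q - q⁻¹)) * (intBinom (2 * j + k - 3) (i - 1) : F) *
      ((intBinom ((n : ℤ) - 2) (k + j - 3) : F)
        + ((ρ + q) / (1 + ρ * q) + (1 + τ * q) / (τ + q)) *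
            (intBinom ((n : ℤ) - 2) (k + j - 2) : F)
        + ((ρ + q) * (1 + τ * q)) / ((1 + ρ * q) * (τ + q)) *
            (intBinom ((n : ℤ) - 2) (k + j - 1) : F))

/-- The `n × n` matrix `K`. -/
noncomputable def kMatrix {F : Type*} [Field F] (n : ℕ) (q ρ τ : F) : Matrix (Fin n) (Fin n) F :=
  Matrix.of fun i j => kEntry n q ρ τ ((i : ℕ) + 1) ((j : ℕ) + 1)

/-! An alternating sign matrix is a state of the six-vertex model with domain wall boundary: its row
and column partial sums, all `0` or `1`, are the states of the horizontal and vertical edges. With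
column parameters `1`, a row of parameter `1` gives every zero entry the weight `1 - q`, so only the
number of `-1`'s matters. The first and last rows contain no `-1`, and there the parameters `(ρ + q)
/ (1 + ρ q)` and `(1 + τ q) / (τ + q)` make the ratio of the weights of zeros left and right of the
`1` equal to `ρ` and `τ`. So `asmGF` is, up to explicit factors, the partition function `dwbc` at
these parameters.

For general parameters `dwbc` is given by the Izergin–Korepin determinant in Lascoux's form
(`ikDet_eq_dwbc`). As functions of the first row parameter `t`, both sides are polynomials of degree
at most `n` for size `n + 1`. At `t = q x₀` both reduce to size `n` (`dwbc_cons_cons`,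
`ikDet_cons_cons`), and symmetry in the column parameters, which for `dwbc` comes from the
Yang–Baxter equation (`columnOp_commute`), gives agreement at all `n + 1` points `q xᵢ`.

The formula carries a Vandermonde factor in the column parameters. Newton interpolation removes it,
and when all points merge at `1` the divided differences become Taylor coefficients
(`det_taylor_coeff_eq_dwbc`). The Taylor coefficients of a monomial are the row-dependent binomials
of `K`, while the bracket in `K` is a coefficient of `(X + 1)^(n - 2) (X + a) (X + b)`, the product
of `X + y` over the row parameters `y`. -/

/-! ### The six-vertex model and the Yang–Baxter equation -/

/-- The weight of a vertex of the six-vertex model with column parameter `X` and row parameter `y`.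
The arguments are the states of the left, right, upper and lower edge. -/
def vertexWeight {R : Type*} [CommRing R] (q κ X y : R) : Bool → Bool → Bool → Bool → R
  | false, false, false, false => y - q * X
  | false, false, true, true => X - q * y
  | true, true, false, false => X - q * y
  | true, true, true, true => y - q * X
  | false, true, false, true => 1
  | true, false, true, false => κ * X * y
  | false, false, false, true => 0
  | false, false, true, false => 0
  | true, true, false, true => 0
  | true, true, true, false => 0
  | false, true, false, false => 0
  | false, true, true, false => 0
  | false, true, true, true => 0
  | true, false, false, false => 0
  | true, false, false, true => 0
  | true, false, true, true => 0

/-- The monodromy matrix of a column of vertices whose left and right edges are given. -/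
def monodromy {R : Type*} [CommRing R] (q κ X : R) :
    (N : ℕ) → (Fin N → R) → (Fin N → Bool) → (Fin N → Bool) → Matrix Bool Bool R
  | 0, _, _, _ => 1
  | N + 1, y, h, h' => Matrix.of (vertexWeight q κ X (y 0) (h 0) (h' 0)) *
      monodromy q κ X N (Fin.tail y) (Fin.tail h) (Fin.tail h')

theorem monodromy_succ_apply {R : Type*} [CommRing R] (q κ X : R) (N : ℕ) (y : Fin (N + 1) → R)
    (h h' : Fin (N + 1) → Bool) (s t : Bool) :
    monodromy q κ X (N + 1) y h h' s t = ∑ m, vertexWeight q κ X (y 0) (h 0) (h' 0) s m *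
      monodromy q κ X N (Fin.tail y) (Fin.tail h) (Fin.tail h') m t :=
  rfl

/-- The transfer matrix of a column of vertices with upper edge `s` and lower edge `t`. -/
def columnOp {R : Type*} [CommRing R] (q κ X : R) {N : ℕ} (y : Fin N → R) (s t : Bool) :
    Matrix (Fin N → Bool) (Fin N → Bool) R :=
  Matrix.of fun h h' => monodromy q κ X N y h h' s t

/-- Two vertices side by side, as a matrix from the upper to the lower edges. -/
def doubleWeight {R : Type*} [CommRing R] (q κ X X' y : R) (l r : Bool) :
    Matrix (Bool × Bool) (Bool × Bool) R :=
  Matrix.of fun p p' => ∑ m, vertexWeight q κ X y l m p.1 p'.1 * vertexWeight q κ X' y m r p.2 p'.2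

/-- The monodromy matrix of two adjacent columns of vertices. -/
def doubleMonodromy {R : Type*} [CommRing R] (q κ X X' : R) :
    (N : ℕ) → (Fin N → R) → (Fin N → Bool) → (Fin N → Bool) →
      Matrix (Bool × Bool) (Bool × Bool) R
  | 0, _, _, _ => 1
  | N + 1, y, h, h' => doubleWeight q κ X X' (y 0) (h 0) (h' 0) *
      doubleMonodromy q κ X X' N (Fin.tail y) (Fin.tail h) (Fin.tail h')

/-- The intertwining matrix of the Yang–Baxter equation. -/
def rMatrix {R : Type*} [CommRing R] (q X X' : R) : Bool × Bool → Bool × Bool → R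
  | (false, false), (false, false) => X - q ^ 2 * X'
  | (true, true), (true, true) => X - q ^ 2 * X'
  | (false, true), (false, true) => (1 - q ^ 2) * X
  | (false, true), (true, false) => q * (X' - X)
  | (true, false), (false, true) => q * (X' - X)
  | (true, false), (true, false) => (1 - q ^ 2) * X'
  | (false, false), (false, true) => 0
  | (false, false), (true, false) => 0
  | (false, false), (true, true) => 0
  | (false, true), (false, false) => 0
  | (false, true), (true, true) => 0
  | (true, false), (false, false) => 0
  | (true, false), (true, true) => 0
  | (true, true), (false, false) => 0
  | (true, true), (false, true) => 0
  | (true, true), (true, false) => 0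

theorem sum_fin_succ_fun {M S : Type*} [AddCommMonoid M] [Fintype S] {n : ℕ}
    (f : (Fin (n + 1) → S) → M) : ∑ p, f p = ∑ c : S, ∑ p : Fin n → S, f (Fin.cons c p) := by
  rw [← Fintype.sum_prod_type' (f := fun (c : S) (p : Fin n → S) => f (Fin.cons c p))]
  exact (Fintype.sum_equiv (Fin.consEquiv fun _ => S) _ _ fun _ => rfl).symm

theorem sum_sum_mul_sum_mul_sum {R ι₁ ι₂ ι₃ ι₄ : Type*} [CommRing R] [Fintype ι₁] [Fintype ι₂]
    [Fintype ι₃] [Fintype ι₄] (w : ι₁ → ι₃ → R) (w' : ι₁ → ι₄ → R) (f : ι₂ → ι₃ → R)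
    (f' : ι₂ → ι₄ → R) :
    ∑ b, ∑ h, (∑ m, w b m * f h m) * ∑ m', w' b m' * f' h m' =
      ∑ m, ∑ m', (∑ b, w b m * w' b m') * ∑ h, f h m * f' h m' := by
  simp only [Finset.sum_mul_sum]
  rw [Finset.sum_congr rfl fun b _ => Finset.sum_comm, Finset.sum_comm]
  refine Finset.sum_congr rfl fun m _ => ?_
  rw [Finset.sum_congr rfl fun b _ => Finset.sum_comm, Finset.sum_comm]
  exact Finset.sum_congr rfl fun m' _ => Finset.sum_congr rfl fun b _ =>
    Finset.sum_congr rfl fun h _ => by ring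

/-- Both sides sum over the same edge states of two adjacent columns, once column by column and once
row by row. -/
theorem sum_monodromy_mul {R : Type*} [CommRing R] (q κ X X' : R) :
    ∀ (N : ℕ) (y : Fin N → R) (h h'' : Fin N → Bool) (s s' t t' : Bool),
      ∑ h', monodromy q κ X N y h h' s t * monodromy q κ X' N y h' h'' s' t' =
        doubleMonodromy q κ X X' N y h h'' (s, s') (t, t')
  | 0, y, h, h'', s, s', t, t' => by
    cases s <;> cases s' <;> cases t <;> cases t' <;>
      simp [monodromy, doubleMonodromy]
  | N + 1, y, h, h'', s, s', t, t' => by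
    rw [sum_fin_succ_fun]
    simp only [monodromy_succ_apply]
    refine (sum_sum_mul_sum_mul_sum (fun b m => vertexWeight q κ X (y 0) (h 0) b s m)
      (fun b m => vertexWeight q κ X' (y 0) b (h'' 0) s' m)
      (fun k m => monodromy q κ X N (Fin.tail y) (Fin.tail h) k m t)
      (fun k m => monodromy q κ X' N (Fin.tail y) k (Fin.tail h'') m t')).trans ?_
    rw [doubleMonodromy, Matrix.mul_apply, Fintype.sum_prod_type]
    exact Finset.sum_congr rfl fun m _ => Finset.sum_congr rfl fun m' _ =>
      congrArg _ (sum_monodromy_mul q κ X X' N _ _ _ _ _ _ _)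

-- The local Yang–Baxter equation, a finite check over edge states. The row parameter `y` does not
-- occur in `rMatrix`, which is what lets the same matrix pass through all rows of a column pair.
set_option maxHeartbeats 4000000 in
theorem rMatrix_mul_doubleWeight {R : Type*} [CommRing R] {q κ : R} (hκ : q * κ = (1 - q ^ 2) ^ 2)
    (X X' y : R) (l r : Bool) :
    Matrix.of (rMatrix q X X') * doubleWeight q κ X X' y l r =
      doubleWeight q κ X' X y l r * Matrix.of (rMatrix q X X') := by
  ext ⟨s, s'⟩ ⟨t, t'⟩
  cases l <;> cases r <;> cases s <;> cases s' <;> cases t <;> cases t' <;>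
    simp only [Matrix.mul_apply, Fintype.sum_prod_type, Fintype.sum_bool, Matrix.of_apply, rMatrix,
      doubleWeight, vertexWeight, mul_zero, zero_mul, add_zero, zero_add] <;>
    first
      | ring1
      | grind

theorem rMatrix_mul_doubleMonodromy {R : Type*} [CommRing R] {q κ : R} (hκ : q * κ = (1 - q ^ 2) ^ 2)
    (X X' : R) : ∀ (N : ℕ) (y : Fin N → R) (h h' : Fin N → Bool),
    Matrix.of (rMatrix q X X') * doubleMonodromy q κ X X' N y h h' =
      doubleMonodromy q κ X' X N y h h' * Matrix.of (rMatrix q X X')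
  | 0, y, h, h' => by simp [doubleMonodromy]
  | N + 1, y, h, h' => by
    rw [doubleMonodromy, doubleMonodromy, ← Matrix.mul_assoc, rMatrix_mul_doubleWeight hκ,
      Matrix.mul_assoc, rMatrix_mul_doubleMonodromy hκ, Matrix.mul_assoc]

theorem columnOp_commute {R : Type*} [CommRing R] [IsDomain R] {q κ : R} (hκ : q * κ = (1 - q ^ 2) ^ 2)
    {X X' : R} (hX : X - q ^ 2 * X' ≠ 0) {N : ℕ} (y : Fin N → R) :
    Commute (columnOp q κ X y false true)
      (columnOp q κ X' y false true) := by
  ext h h'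
  simp only [Matrix.mul_apply, columnOp, Matrix.of_apply, sum_monodromy_mul]
  -- On the pairs of equal edges `rMatrix` acts by the scalar `X - q ^ 2 * X'`, so this entry of the
  -- intertwining relation is the commutation relation times that scalar.
  have key := congrFun (congrFun (rMatrix_mul_doubleMonodromy hκ X X' N y h h') (false, false))
    (true, true)
  simp only [Matrix.mul_apply, Fintype.sum_prod_type, Fintype.sum_bool, Matrix.of_apply, rMatrix,
      mul_zero, zero_mul, add_zero, zero_add] at key
  exact mul_left_cancel₀ hX (key.trans (mul_comm _ _))

/-! ### The domain wall partition function: symmetry, degree and recursion -/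

/-- The product of the transfer matrices of columns with parameters `l`, each with upper edge
`false` and lower edge `true`. -/
def latticeOp {R : Type*} [CommRing R] (q κ : R) {N : ℕ} (y : Fin N → R) (l : List R) :
    Matrix (Fin N → Bool) (Fin N → Bool) R :=
  (l.map fun X => columnOp q κ X y false true).prod

/-- The partition function of the six-vertex model with domain wall boundary conditions. -/
def dwbc {R : Type*} [CommRing R] (q κ : R) {N : ℕ} (y : Fin N → R) (l : List R) : R :=
  latticeOp q κ y l (fun _ => false) (fun _ => true)

theorem columnOp_cons {R : Type*} [CommRing R] (q κ X t : R) {N : ℕ} (y : Fin N → R) (s u b b' : Bool)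
    (h h' : Fin N → Bool) :
    columnOp q κ X (Fin.cons t y : Fin (N + 1) → R) s u (Fin.cons b h : Fin (N + 1) → Bool)
        (Fin.cons b' h' : Fin (N + 1) → Bool) =
      ∑ m, vertexWeight q κ X t b b' s m * columnOp q κ X y m u h h' :=
  monodromy_succ_apply q κ X N _ _ _ s u

theorem latticeOp_nil {R : Type*} [CommRing R] (q κ : R) {N : ℕ} (y : Fin N → R) :
    latticeOp q κ y [] = 1 :=
  rfl

theorem latticeOp_cons {R : Type*} [CommRing R] (q κ : R) {N : ℕ} (y : Fin N → R) (X : R)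
    (l : List R) : latticeOp q κ y (X :: l) = columnOp q κ X y false true * latticeOp q κ y l := by
  simp [latticeOp]

theorem latticeOp_cons_apply {R : Type*} [CommRing R] (q κ t : R) {N : ℕ} (y : Fin N → R) (X : R)
    (l : List R) (b : Bool) (h : Fin N → Bool) (h' : Fin (N + 1) → Bool) :
    latticeOp q κ (Fin.cons t y : Fin (N + 1) → R) (X :: l)
        (Fin.cons b h : Fin (N + 1) → Bool) h' =
      ∑ b', ∑ k, (∑ m, vertexWeight q κ X t b b' false m * columnOp q κ X y m true h k) *
        latticeOp q κ (Fin.cons t y : Fin (N + 1) → R) l (Fin.cons b' k : Fin (N + 1) → Bool) h' := by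
  rw [latticeOp_cons, Matrix.mul_apply, sum_fin_succ_fun]
  simp only [columnOp_cons]

/-- Below an upper edge `false`, a horizontal `true` cannot turn back into `false`, so the whole top
row is frozen. -/
theorem latticeOp_true_true {R : Type*} [CommRing R] (q κ t : R) {N : ℕ} (y : Fin N → R)
    (l : List R) (h h' : Fin N → Bool) :
    latticeOp q κ (Fin.cons t y : Fin (N + 1) → R) l (Fin.cons true h : Fin (N + 1) → Bool)
      (Fin.cons true h' : Fin (N + 1) → Bool) =
        (l.map fun X => X - q * t).prod * latticeOp q κ y l h h' := by
  induction l generalizing h with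
  | nil => simp [latticeOp_nil, Matrix.one_apply, Fin.cons_inj]
  | cons X l ih =>
    rw [latticeOp_cons_apply, latticeOp_cons, Matrix.mul_apply]
    simp only [ih, Fintype.sum_bool, vertexWeight, List.map_cons, List.prod_cons, Finset.mul_sum]
    simp only [zero_mul, zero_add, Finset.sum_const_zero, add_zero]
    exact Finset.sum_congr rfl fun k _ => by ring

/-- The top row switches from `false` to `true` exactly once. Either the switch is still to come, or
it occurs in the first column and the rest of the row is frozen. -/
theorem latticeOp_false_true_cons {R : Type*} [CommRing R] (q κ t : R) {N : ℕ} (y : Fin N → R)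
    (X : R) (l : List R) (h h' : Fin N → Bool) :
    latticeOp q κ (Fin.cons t y : Fin (N + 1) → R) (X :: l)
        (Fin.cons false h : Fin (N + 1) → Bool) (Fin.cons true h' : Fin (N + 1) → Bool) =
      (∑ k, (t - q * X) * columnOp q κ X y false true h k *
        latticeOp q κ (Fin.cons t y : Fin (N + 1) → R) l (Fin.cons false k : Fin (N + 1) → Bool)
          (Fin.cons true h' : Fin (N + 1) → Bool)) +
      ∑ k, columnOp q κ X y true true h k *
        ((l.map fun X => X - q * t).prod * latticeOp q κ y l k h') := by
  rw [latticeOp_cons_apply]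
  simp only [Fintype.sum_bool, vertexWeight, latticeOp_true_true]
  rw [add_comm]
  simp

/-- The parameter `t` enters only through the top row, where the switching vertex has weight `1` and
every other vertex is linear in `t`. -/
theorem exists_polynomial_latticeOp {R : Type*} [CommRing R] (q κ : R) {N : ℕ}
    (y : Fin N → R) (l : List R) (h h' : Fin N → Bool) :
    ∃ p ∈ Polynomial.degreeLT R l.length, ∀ t, p.eval t =
      latticeOp q κ (Fin.cons t y : Fin (N + 1) → R) l (Fin.cons false h : Fin (N + 1) → Bool)
        (Fin.cons true h' : Fin (N + 1) → Bool) := by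
  induction l generalizing h with
  | nil =>
    refine ⟨0, Submodule.zero_mem _, fun t => ?_⟩
    rw [latticeOp_nil, Matrix.one_apply_ne, Polynomial.eval_zero]
    exact fun e => by simpa using congrFun e 0
  | cons X l ih =>
    choose p hp hpe using ih
    have hdeg : ∀ l' : List R, (l'.map fun X => Polynomial.C X -
        Polynomial.C q * Polynomial.X).prod ∈ Polynomial.degreeLT R (l'.length + 1) := by
      intro l'
      rw [Polynomial.mem_degreeLT]
      refine lt_of_le_of_lt (Polynomial.degree_list_prod_le _) ?_
      refine lt_of_le_of_lt (List.sum_le_card_nsmul _ 1 ?_) ?_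
      · simp only [List.mem_map, forall_exists_index, and_imp, forall_apply_eq_imp_iff₂]
        intro a _
        compute_degree
      · simp only [List.length_map, nsmul_eq_mul, mul_one]
        exact_mod_cast Nat.lt_succ_self _
    refine ⟨(∑ k, (Polynomial.X - Polynomial.C (q * X)) *
        Polynomial.C (columnOp q κ X y false true h k) * p k) +
      ∑ k, Polynomial.C (columnOp q κ X y true true h k * latticeOp q κ y l k h') *
        (l.map fun X => Polynomial.C X - Polynomial.C q * Polynomial.X).prod, ?_, fun t => ?_⟩
    · refine Submodule.add_mem _ (Submodule.sum_mem _ fun k _ => ?_)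
        (Submodule.sum_mem _ fun k _ => ?_)
      · by_cases hk : p k = 0
        · rw [hk, mul_zero]; exact Submodule.zero_mem _
        have := Polynomial.mem_degreeLT.1 (hp k)
        rw [Polynomial.degree_eq_natDegree hk] at this
        have h2 : (p k).natDegree < l.length := by exact_mod_cast this
        rw [Polynomial.mem_degreeLT]
        refine lt_of_le_of_lt Polynomial.degree_le_natDegree ?_
        rw [Nat.cast_lt, List.length_cons]
        refine lt_of_le_of_lt Polynomial.natDegree_mul_le ?_
        have : ((Polynomial.X - Polynomial.C (q * X)) *
          Polynomial.C (columnOp q κ X y false true h k)).natDegree ≤ 1 := by compute_degree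
        omega
      · rw [← Polynomial.smul_eq_C_mul]
        exact Submodule.smul_mem _ _ (hdeg l)
    · rw [latticeOp_false_true_cons]
      simp only [Polynomial.eval_add, Polynomial.eval_finsetSum, Polynomial.eval_mul,
        Polynomial.eval_sub, Polynomial.eval_C, Polynomial.eval_X, hpe,
        Polynomial.eval_list_prod, List.map_map, Function.comp_def]
      congr 1
      exact Finset.sum_congr rfl fun k _ => by ring

theorem const_eq_cons {α : Type*} {N : ℕ} (b : α) :
    (fun _ : Fin (N + 1) => b) = (Fin.cons b fun _ => b : Fin (N + 1) → α) := by
  ext i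
  cases i using Fin.cases <;> rfl

/-- A vertex with left edge `false` and upper edge `true` has one admissible completion, which
passes both states on. -/
theorem columnOp_true_true_false {R : Type*} [CommRing R] (q κ X : R) :
    ∀ {N : ℕ} (y : Fin N → R) (k : Fin N → Bool),
      columnOp q κ X y true true (fun _ => false) k =
        if k = fun _ => false then ∏ r, (X - q * y r) else 0
  | 0, y, k => by
    simp [columnOp, monodromy, Subsingleton.elim k fun _ => false]
  | N + 1, y, k => by
    induction y using Fin.consCases with | _ t y => ?_
    induction k using Fin.consCases with | _ b k => ?_
    rw [const_eq_cons false, columnOp_cons]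
    have ih := columnOp_true_true_false q κ X y k
    cases b <;> simp [vertexWeight, ih, Fin.cons_inj, Fin.prod_univ_succ]

/-- At `t = q X` the weight `t - q X` vanishes, which forces the switch of the top row into the
first column. That row and column freeze, leaving a smaller domain wall. -/
theorem dwbc_cons_cons {R : Type*} [CommRing R] (q κ : R) {N : ℕ} (y : Fin N → R) (X : R)
    (l : List R) :
    dwbc q κ (Fin.cons (q * X) y : Fin (N + 1) → R) (X :: l) =
      (∏ r, (X - q * y r)) * (l.map fun X' => X' - q ^ 2 * X).prod * dwbc q κ y l := by
  rw [dwbc, const_eq_cons false, const_eq_cons true, latticeOp_false_true_cons]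
  simp [columnOp_true_true_false, dwbc, pow_two, mul_assoc]

theorem exists_polynomial_dwbc {R : Type*} [CommRing R] (q κ : R) {N : ℕ}
    (y : Fin N → R) (l : List R) :
    ∃ p ∈ Polynomial.degreeLT R l.length, ∀ t, p.eval t =
      dwbc q κ (Fin.cons t y : Fin (N + 1) → R) l := by
  simp only [dwbc, const_eq_cons true, const_eq_cons false]
  exact exists_polynomial_latticeOp q κ y l _ _

theorem dwbc_perm {R : Type*} [CommRing R] [IsDomain R] {q κ : R} (hκ : q * κ = (1 - q ^ 2) ^ 2)
    {N : ℕ} (y : Fin N → R) {l l' : List R} (hl : l.Perm l')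
    (hp : l.Pairwise fun X X' => X - q ^ 2 * X' ≠ 0) : dwbc q κ y l = dwbc q κ y l' := by
  rw [dwbc, latticeOp, (hl.map _).prod_eq', dwbc, latticeOp]
  exact List.pairwise_map.2 (hp.imp fun h => columnOp_commute hκ h y)

/-! ### The Lascoux determinant -/

/-- The entries of the Lascoux form of the Izergin–Korepin determinant. -/
def ikEntry {R : Type*} [CommRing R] (q qi : R) {N : ℕ} (y : Fin N → R) (X : R) (j : ℕ) : R :=
  (qi * X) ^ j * ∏ r, (y r - q * X) - (q * X) ^ j * ∏ r, (y r - qi * X)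

/-- The Lascoux form of the Izergin–Korepin determinant. -/
def ikDet {R : Type*} [CommRing R] (q qi : R) {n : ℕ} (y x : Fin n → R) : R :=
  (Matrix.of fun i j : Fin n => ikEntry q qi y (x i) j).det

/-- The factor `y₀ - q X` kills one of the two terms in the row of `X`, which becomes geometric with
ratio `q X`. Subtracting `q X` times the preceding column clears that row past its first entry, and
each other row acquires the factor `(X - xᵢ) (xᵢ - q² X)`. -/
theorem ikDet_cons_cons {R : Type*} [CommRing R] {q qi : R} (hq : q * qi = 1) {n : ℕ} (X : R)
    (y x : Fin n → R) :
    ikDet q qi (Fin.cons (q * X) y : Fin (n + 1) → R) (Fin.cons X x : Fin (n + 1) → R) =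
      (qi - q) * X * (∏ r, (y r - qi * X)) * (∏ i, (X - x i) * (x i - q ^ 2 * X)) *
        ikDet q qi y x := by
  set Y : Fin (n + 1) → R := Fin.cons (q * X) y with hY
  set Z : Fin (n + 1) → R := Fin.cons X x with hZ
  have hrec : ∀ (i : Fin (n + 1)) (j : ℕ), ikEntry q qi Y (Z i) (j + 1) =
      (ikEntry q qi Y (Z i) (j + 1) - q * X * ikEntry q qi Y (Z i) j) +
        q * X * ikEntry q qi Y (Z i) j := fun i j => by ring
  rw [ikDet, Matrix.det_eq_of_forall_col_eq_smul_add_pred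
    (B := Matrix.of fun i j : Fin (n + 1) => Fin.cases (motive := fun _ => R)
      (ikEntry q qi Y (Z i) 0)
      (fun j : Fin n => ikEntry q qi Y (Z i) (j + 1) - q * X * ikEntry q qi Y (Z i) j) j)
    (fun _ => q * X) (fun i => by simp) (fun i j => by simp), Matrix.det_succ_row_zero,
    Fin.sum_univ_succ]
  have h0 : ∀ j : Fin n, ikEntry q qi Y (Z 0) (j + 1) - q * X * ikEntry q qi Y (Z 0) j = 0 := by
    intro j
    simp only [hY, hZ, ikEntry, Fin.prod_univ_succ, Fin.cons_zero, Fin.cons_succ]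
    ring
  rw [Finset.sum_eq_zero fun j _ => by simp [h0 j], ikDet, add_zero, mul_assoc, mul_assoc,
    ← Matrix.det_mul_column]
  simp only [Fin.val_zero, pow_zero, one_mul, Matrix.of_apply, Fin.cases_zero, Fin.succAbove_zero,
    ← mul_assoc]
  congr 1
  · simp only [hY, hZ, ikEntry, Fin.prod_univ_succ, Fin.cons_zero, Fin.cons_succ]
    ring
  · congr 1
    ext i j
    simp only [hY, hZ, ikEntry, Fin.prod_univ_succ, Fin.cons_zero, Fin.cons_succ,
      Matrix.submatrix_apply, Matrix.of_apply, Fin.cases_succ]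
    linear_combination ((qi * x i) ^ (j : ℕ) * (∏ r, (y r - q * x i)) * (x i) * (X - x i) -
      (q * x i) ^ (j : ℕ) * (∏ r, (y r - qi * x i)) * (x i) * (X - x i)) * hq

/-- Every entry is linear in `t`, which only bounds the degree by `n + 1`. Combining the columns
with the coefficients of `f = ∏ (y r - X)` makes the last column independent of `t`, since the terms
linear in `t` both carry `f (q x) f (q⁻¹ x)` and cancel. The coefficient of the last column itself
is the unit `(-1) ^ n`. -/
theorem exists_polynomial_ikDet {R : Type*} [CommRing R] (q qi : R) {n : ℕ} (y : Fin n → R)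
    (x : Fin (n + 1) → R) :
    ∃ p ∈ Polynomial.degreeLT R (n + 1), ∀ t, p.eval t =
      ikDet q qi (Fin.cons t y : Fin (n + 1) → R) x := by
  set f : Polynomial R := ∏ r, (Polynomial.C (y r) - Polynomial.X) with hf
  have hdeg : f.natDegree ≤ n := by
    refine (Polynomial.natDegree_prod_le _ _).trans ?_
    refine (Finset.sum_le_card_nsmul _ _ 1 fun r _ => ?_).trans (by simp)
    compute_degree
  have hcoeff : f.coeff n = (-1) ^ n := by
    have := Polynomial.coeff_prod_of_natDegree_le (s := Finset.univ)
      (f := fun r => Polynomial.C (y r) - Polynomial.X) 1 (fun r _ => by compute_degree)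
    simpa [hf, Polynomial.coeff_C] using this
  have hev : ∀ u, ∑ j : Fin (n + 1), f.coeff j * u ^ (j : ℕ) = ∏ r, (y r - u) := by
    intro u
    rw [Fin.sum_univ_eq_sum_range (fun j => f.coeff j * u ^ j),
      ← Polynomial.eval_eq_sum_range' (Nat.lt_succ_of_le hdeg)]
    simp [hf, Polynomial.eval_prod]
  let A : Matrix (Fin (n + 1)) (Fin (n + 1)) (Polynomial R) := Matrix.of fun i j =>
    Fin.lastCases (motive := fun _ => Polynomial R)
      (Polynomial.C ((∏ r, (y r - q * x i)) * (∏ r, (y r - qi * x i)) * (qi * x i - q * x i)))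
      (fun j : Fin n =>
        Polynomial.C ((qi * x i) ^ (j : ℕ) * ∏ r, (y r - q * x i)) *
          (Polynomial.X - Polynomial.C (q * x i)) -
        Polynomial.C ((q * x i) ^ (j : ℕ) * ∏ r, (y r - qi * x i)) *
          (Polynomial.X - Polynomial.C (qi * x i))) j
  refine ⟨(-1) ^ n * A.det, ?_, fun t => ?_⟩
  · rw [Polynomial.mem_degreeLT]
    refine lt_of_le_of_lt Polynomial.degree_le_natDegree ?_
    rw [Nat.cast_lt, Nat.lt_succ_iff]
    have hA : A.det.natDegree ≤ n := by
      rw [Matrix.det_apply]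
      refine Polynomial.natDegree_sum_le_of_forall_le _ _ fun σ _ => ?_
      refine (Polynomial.natDegree_smul_le _ _).trans ?_
      rw [Fin.prod_univ_castSucc]
      refine Polynomial.natDegree_mul_le.trans ?_
      have h1 : (A (σ (Fin.last n)) (Fin.last n)).natDegree = 0 := by
        simp only [A, Matrix.of_apply, Fin.lastCases_last, Polynomial.natDegree_C]
      rw [h1, add_zero]
      refine (Polynomial.natDegree_prod_le _ _).trans ?_
      refine (Finset.sum_le_card_nsmul _ _ 1 fun j _ => ?_).trans (by simp)
      simp only [A, Matrix.of_apply, Fin.lastCases_castSucc]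
      compute_degree
    rcases neg_one_pow_eq_or (Polynomial R) n with h | h <;> simpa [h] using hA
  · have key := Matrix.det_updateCol_sum
      (Matrix.of fun i j : Fin (n + 1) => ikEntry q qi (Fin.cons t y : Fin (n + 1) → R) (x i) j)
      (Fin.last n) (fun j => f.coeff j)
    have hmap : (Polynomial.evalRingHom t).mapMatrix A = Matrix.updateCol
        (Matrix.of fun i j : Fin (n + 1) => ikEntry q qi (Fin.cons t y : Fin (n + 1) → R) (x i) j)
        (Fin.last n) (fun k => ∑ j : Fin (n + 1), f.coeff j •
          ikEntry q qi (Fin.cons t y : Fin (n + 1) → R) (x k) j) := by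
      ext i j
      cases j using Fin.lastCases with
      | last =>
        have e1 := hev (q * x i)
        have e2 := hev (qi * x i)
        simp only [RingHom.mapMatrix_apply, Matrix.map_apply, A, Matrix.of_apply,
          Fin.lastCases_last, Matrix.updateCol_self, Polynomial.coe_evalRingHom,
          Polynomial.eval_C, ikEntry, Fin.prod_univ_succ, Fin.cons_zero, Fin.cons_succ,
          smul_eq_mul, mul_sub, Finset.sum_sub_distrib]
        rw [Finset.sum_congr rfl fun j _ => (mul_assoc _ _ _).symm, ← Finset.sum_mul, e2,
          Finset.sum_congr rfl fun j _ => (mul_assoc _ _ _).symm, ← Finset.sum_mul, e1]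
        ring
      | cast j =>
        rw [Matrix.updateCol_ne (Fin.castSucc_lt_last j).ne]
        simp only [RingHom.mapMatrix_apply, Matrix.map_apply, A, Matrix.of_apply,
          Fin.lastCases_castSucc, Polynomial.coe_evalRingHom, ikEntry, Fin.prod_univ_succ,
          Fin.cons_zero, Fin.cons_succ, Polynomial.eval_sub, Polynomial.eval_mul,
          Polynomial.eval_C, Polynomial.eval_X, Fin.val_castSucc]
        ring
    have hdet : A.det.eval t = (-1) ^ n *
        ikDet q qi (Fin.cons t y : Fin (n + 1) → R) x := by
      have := (Polynomial.evalRingHom t).map_det A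
      rw [hmap] at this
      refine this.trans (key.trans ?_)
      simp [hcoeff, ikDet]
    rw [Polynomial.eval_mul, hdet, ← mul_assoc]
    simp [← mul_pow]

/-! ### The Izergin–Korepin formula by interpolation -/

theorem det_vandermonde_cons {R : Type*} [CommRing R] {n : ℕ} (X : R) (x : Fin n → R) :
    (Matrix.vandermonde (Fin.cons X x : Fin (n + 1) → R)).det =
      (∏ i, (x i - X)) * (Matrix.vandermonde x).det := by
  simp only [Matrix.det_vandermonde, Fin.prod_univ_succ, Fin.prod_Ioi_zero, Fin.prod_Ioi_succ,
    Fin.cons_zero, Fin.cons_succ]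

theorem ikDet_comp_perm {R : Type*} [CommRing R] (q qi : R) {n : ℕ} (y x : Fin n → R)
    (σ : Equiv.Perm (Fin n)) :
    ikDet q qi y (x ∘ σ) = Equiv.Perm.sign σ * ikDet q qi y x :=
  Matrix.det_permute σ (Matrix.of fun i j : Fin n => ikEntry q qi y (x i) j)

theorem det_vandermonde_comp_perm {R : Type*} [CommRing R] {n : ℕ} (x : Fin n → R)
    (σ : Equiv.Perm (Fin n)) :
    (Matrix.vandermonde (x ∘ σ)).det = Equiv.Perm.sign σ * (Matrix.vandermonde x).det :=
  Matrix.det_permute σ (Matrix.vandermonde x)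

theorem pairwise_ofFn_ne {R : Type*} [CommRing R] {q : R} {n : ℕ} {x : Fin n → R}
    (hx : ∀ i j, i ≠ j → x i - q ^ 2 * x j ≠ 0) :
    (List.ofFn x).Pairwise fun X X' => X - q ^ 2 * X' ≠ 0 :=
  List.pairwise_ofFn.2 fun i j hij => hx i j hij.ne

/-- The Izergin–Korepin formula, in the form of Lascoux. -/
theorem ikDet_eq_dwbc {R : Type*} [CommRing R] [IsDomain R] {q qi κ : R} (hq : q * qi = 1)
    (hκ : q * κ = (1 - q ^ 2) ^ 2) {n : ℕ} (y x : Fin n → R) (hinj : Function.Injective x)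
    (hx : ∀ i j, i ≠ j → x i - q ^ 2 * x j ≠ 0) :
    q ^ n.choose 2 * ikDet q qi y x =
      (qi - q) ^ n * (∏ i, x i) * (Matrix.vandermonde x).det * dwbc q κ y (List.ofFn x) := by
  induction n with
  | zero => simp [ikDet, dwbc, latticeOp_nil, Matrix.one_apply, funext_iff]
  | succ n ih =>
    induction y using Fin.consCases with | _ t y => ?_
    -- The two recursions match at `t = q x₀`; the other nodes follow by symmetry.
    have special : ∀ x : Fin (n + 1) → R, Function.Injective x →
        (∀ i j, i ≠ j → x i - q ^ 2 * x j ≠ 0) →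
        q ^ (n + 1).choose 2 * ikDet q qi (Fin.cons (q * x 0) y : Fin (n + 1) → R) x =
          (qi - q) ^ (n + 1) * (∏ i, x i) * (Matrix.vandermonde x).det *
            dwbc q κ (Fin.cons (q * x 0) y : Fin (n + 1) → R) (List.ofFn x) := by
      intro x hinj hx
      induction x using Fin.consCases with | _ X x => ?_
      have ih' := ih y x (fun i j h => by simpa using @hinj i.succ j.succ (by simpa using h))
        (fun i j h => by simpa using hx i.succ j.succ (by simpa using h))
      have h1 : q ^ n * ∏ r, (y r - qi * X) = (-1) ^ n * ∏ r, (X - q * y r) := by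
        have h : ∀ c : R, c ^ n = ∏ _r : Fin n, c := fun c => by simp
        rw [h q, h (-1), ← Finset.prod_mul_distrib, ← Finset.prod_mul_distrib]
        exact Finset.prod_congr rfl fun r _ => by linear_combination (-X) * hq
      have h2 : ∏ i, (X - x i) = (-1) ^ n * ∏ i, (x i - X) := by
        have h : ∀ c : R, c ^ n = ∏ _r : Fin n, c := fun c => by simp
        rw [h (-1), ← Finset.prod_mul_distrib]
        exact Finset.prod_congr rfl fun r _ => by ring
      have h3 : ((-1 : R) ^ n) * (-1) ^ n = 1 := by simp [← mul_pow]
      rw [Fin.cons_zero, ikDet_cons_cons hq, List.ofFn_succ, Fin.cons_zero, dwbc_cons_cons,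
        det_vandermonde_cons, Fin.prod_univ_succ, Finset.prod_mul_distrib, h2,
        Nat.choose_succ_succ' n 1, Nat.choose_one_right, pow_add]
      simp only [Fin.cons_zero, Fin.cons_succ, List.map_ofFn, List.prod_ofFn, Function.comp_def]
      set a := ∏ r, (y r - qi * X)
      set b := ∏ r, (X - q * y r)
      set c := ∏ i, (x i - X)
      set d := ∏ i, (x i - q ^ 2 * X)
      linear_combination (q ^ n * a) * ((qi - q) * X * ((-1) ^ n * c * d)) * ih' +
        ((qi - q) * X * ((-1) ^ n * c * d)) * ((qi - q) ^ n * (∏ i, x i) *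
          (Matrix.vandermonde x).det * dwbc q κ y (List.ofFn x)) * h1 +
        b * ((qi - q) * X * (c * d)) * ((qi - q) ^ n * (∏ i, x i) *
          (Matrix.vandermonde x).det * dwbc q κ y (List.ofFn x)) * h3
    obtain ⟨p, hp, hpe⟩ := exists_polynomial_dwbc q κ y (List.ofFn x)
    obtain ⟨r, hr, hre⟩ := exists_polynomial_ikDet q qi y x
    rw [List.length_ofFn] at hp
    -- Interpolation at the `n + 1` nodes `q xᵢ`, which are distinct because `q` is invertible.
    have hzero : q ^ (n + 1).choose 2 • r -
        ((qi - q) ^ (n + 1) * (∏ i, x i) * (Matrix.vandermonde x).det) • p = 0 := by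
      refine Polynomial.eq_zero_of_degree_lt_of_eval_index_eq_zero (s := Finset.univ)
        (v := fun i => q * x i) ?_ ?_ ?_
      · intro i _ j _ h
        refine hinj ?_
        linear_combination qi * h - (x i - x j) * hq
      · rw [Finset.card_univ, Fintype.card_fin]
        exact Polynomial.mem_degreeLT.1 (Submodule.sub_mem _ (Submodule.smul_mem _ _ hr)
          (Submodule.smul_mem _ _ hp))
      · intro i _
        -- Swapping `x₀` and `xᵢ` multiplies the determinant and the Vandermonde by the same sign
        -- and leaves the partition function unchanged.
        have hs := special (x ∘ Equiv.swap 0 i) (hinj.comp (Equiv.injective _))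
          (fun j k h => hx _ _ ((Equiv.injective _).ne h))
        have hperm := dwbc_perm hκ (Fin.cons (q * x i) y : Fin (n + 1) → R)
          (Equiv.Perm.ofFn_comp_perm (Equiv.swap 0 i) x).symm (pairwise_ofFn_ne hx)
        rw [ikDet_comp_perm, det_vandermonde_comp_perm, Function.comp_apply,
          Equiv.swap_apply_left, ← hperm, Function.comp_def,
          Equiv.prod_comp (Equiv.swap 0 i) x] at hs
        simp only [Polynomial.eval_sub, Polynomial.eval_smul, hre, hpe, smul_eq_mul]
        have hsq : ((Equiv.Perm.sign (Equiv.swap 0 i) : ℤ) : R) *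
            (Equiv.Perm.sign (Equiv.swap 0 i) : ℤ) = 1 := by
          rw [← Int.cast_mul, Int.units_coe_mul_self, Int.cast_one]
        linear_combination ((Equiv.Perm.sign (Equiv.swap 0 i) : ℤ) : R) * hs -
          (q ^ (n + 1).choose 2 * ikDet q qi (Fin.cons (q * x i) y : Fin (n + 1) → R) x -
            (qi - q) ^ (n + 1) * (∏ i, x i) * (Matrix.vandermonde x).det *
              dwbc q κ (Fin.cons (q * x i) y : Fin (n + 1) → R) (List.ofFn x)) * hsq
    have := congrArg (Polynomial.eval t) hzero
    simp only [Polynomial.eval_sub, Polynomial.eval_smul, hre, hpe, smul_eq_mul,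
      Polynomial.eval_zero] at this
    exact sub_eq_zero.1 this

/-! ### Divided differences and the limit of equal column parameters -/

/-- The divided differences of a polynomial at the given points. -/
noncomputable def dividedDiff {R : Type*} [CommRing R] :
    (n : ℕ) → (Fin n → R) → Polynomial R → Fin n → R
  | 0, _, _ => Fin.elim0
  | n + 1, x, f => Fin.cons (f.eval (x 0))
      (dividedDiff n (Fin.tail x) (f /ₘ (Polynomial.X - Polynomial.C (x 0))))

theorem eq_mul_divByMonic_add {R : Type*} [CommRing R] (f : Polynomial R) (c : R) :
    f = (Polynomial.X - Polynomial.C c) * (f /ₘ (Polynomial.X - Polynomial.C c)) +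
      Polynomial.C (f.eval c) := by
  conv_lhs => rw [← Polynomial.modByMonic_add_div f (Polynomial.X - Polynomial.C c)]
  rw [Polynomial.modByMonic_X_sub_C_eq_C_eval, add_comm]

/-- Newton interpolation: the values at the points arise from the divided differences by a
triangular matrix independent of `f`, whose diagonal entries are products of differences of points.
-/
theorem exists_newton_matrix {R : Type*} [CommRing R] : ∀ (n : ℕ) (x : Fin n → R),
    ∃ A : Matrix (Fin n) (Fin n) R, A.det = (Matrix.vandermonde x).det ∧
      ∀ (f : Polynomial R) (i : Fin n), f.eval (x i) = ∑ k, A i k * dividedDiff n x f k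
  | 0, x => ⟨1, by simp, fun _ i => i.elim0⟩
  | n + 1, x => by
    induction x using Fin.consCases with | _ X x => ?_
    obtain ⟨A, hA, hAe⟩ := exists_newton_matrix n x
    refine ⟨Matrix.of (Fin.cons (Fin.cons 1 fun _ => 0)
      fun i => Fin.cons 1 fun k => (x i - X) * A i k), ?_, fun f i => ?_⟩
    · rw [det_vandermonde_cons, Matrix.det_succ_row_zero, Fin.sum_univ_succ, ← hA,
        ← Matrix.det_mul_column, Finset.sum_eq_zero fun j _ => by simp]
      simp only [Fin.val_zero, pow_zero, one_mul, Matrix.of_apply, Fin.cons_zero, add_zero]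
      congr 1
    · have hf := eq_mul_divByMonic_add f X
      rw [Fin.sum_univ_succ]
      cases i using Fin.cases with
      | zero => simp [dividedDiff]
      | succ i =>
        have h := congrArg (Polynomial.eval (x i)) hf
        rw [Polynomial.eval_add, Polynomial.eval_mul, hAe (f /ₘ _)] at h
        simp only [Polynomial.eval_sub, Polynomial.eval_X, Polynomial.eval_C, Finset.mul_sum] at h
        simp only [dividedDiff, Matrix.of_apply, Fin.cons_succ, Fin.cons_zero, Fin.tail_cons]
        rw [h, add_comm, one_mul]
        congr 1
        exact Finset.sum_congr rfl fun k _ => by ring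

/-- This extracts the Vandermonde factor without division; the remaining determinant still makes
sense when points coincide. -/
theorem det_eval_eq_vandermonde_mul {R : Type*} [CommRing R] {n : ℕ} (x : Fin n → R)
    (f : Fin n → Polynomial R) :
    (Matrix.of fun i j => (f j).eval (x i)).det = (Matrix.vandermonde x).det *
      (Matrix.of fun k j => dividedDiff n x (f j) k).det := by
  obtain ⟨A, hA, hAe⟩ := exists_newton_matrix n x
  rw [← hA, ← Matrix.det_mul]
  congr 1
  ext i j
  simp [Matrix.mul_apply, hAe]

theorem map_dividedDiff {R S : Type*} [CommRing R] [CommRing S] (φ : R →+* S) :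
    ∀ (n : ℕ) (x : Fin n → R) (f : Polynomial R) (k : Fin n),
      φ (dividedDiff n x f k) = dividedDiff n (fun i => φ (x i)) (f.map φ) k
  | 0, _, _, k => k.elim0
  | n + 1, x, f, k => by
    cases k using Fin.cases with
    | zero => simp [dividedDiff]
    | succ k =>
      simp only [dividedDiff, Fin.cons_succ, map_dividedDiff φ n,
        Polynomial.map_divByMonic φ (Polynomial.monic_X_sub_C _)]
      simp [Fin.tail_def]

/-- Repeated division by `X - c` strips off the Taylor coefficients at `c` one at a time. -/
theorem dividedDiff_const {R : Type*} [CommRing R] (c : R) :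
    ∀ (n : ℕ) (f : Polynomial R) (k : Fin n),
      dividedDiff n (fun _ => c) f k = (Polynomial.taylor c f).coeff k
  | 0, _, k => k.elim0
  | n + 1, f, k => by
    cases k using Fin.cases with
    | zero => simp [dividedDiff, Polynomial.taylor_coeff_zero]
    | succ k =>
      conv_rhs => rw [eq_mul_divByMonic_add f c]
      simp only [dividedDiff, Fin.cons_succ, Fin.tail_def, dividedDiff_const c n]
      simp [Polynomial.taylor_mul]

theorem map_vertexWeight {R S : Type*} [CommRing R] [CommRing S] (φ : R →+* S) (q κ X y : R)
    (a b c d : Bool) :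
    φ (vertexWeight q κ X y a b c d) = vertexWeight (φ q) (φ κ) (φ X) (φ y) a b c d := by
  cases a <;> cases b <;> cases c <;> cases d <;> simp [vertexWeight]

theorem map_monodromy {R S : Type*} [CommRing R] [CommRing S] (φ : R →+* S) (q κ X : R) :
    ∀ (N : ℕ) (y : Fin N → R) (h h' : Fin N → Bool) (s t : Bool),
      φ (monodromy q κ X N y h h' s t) =
        monodromy (φ q) (φ κ) (φ X) N (fun i => φ (y i)) h h' s t
  | 0, y, h, h', s, t => by
    cases s <;> cases t <;> simp [monodromy]
  | N + 1, y, h, h', s, t => by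
    rw [monodromy_succ_apply, monodromy_succ_apply, map_sum]
    exact Finset.sum_congr rfl fun m _ => by
      rw [map_mul, map_vertexWeight, map_monodromy φ]
      rfl

theorem map_dwbc {R S : Type*} [CommRing R] [CommRing S] (φ : R →+* S) (q κ : R) {N : ℕ}
    (y : Fin N → R) (l : List R) :
    φ (dwbc q κ y l) = dwbc (φ q) (φ κ) (fun i => φ (y i)) (l.map φ) := by
  have h : φ.mapMatrix (latticeOp q κ y l) =
      latticeOp (φ q) (φ κ) (fun i => φ (y i)) (l.map φ) := by
    rw [latticeOp, map_list_prod, latticeOp, List.map_map, List.map_map]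
    congr 1
    refine List.map_congr_left fun X _ => ?_
    ext h h'
    simp [columnOp, map_monodromy]
  exact congrFun (congrFun h _) _

theorem map_ikEntry {R S : Type*} [CommRing R] [CommRing S] (φ : R →+* S) (q qi : R) {N : ℕ}
    (y : Fin N → R) (X : R) (j : ℕ) :
    φ (ikEntry q qi y X j) = ikEntry (φ q) (φ qi) (fun i => φ (y i)) (φ X) j := by
  simp [ikEntry]

open Polynomial in
/-- The Izergin–Korepin formula in the limit where all column parameters are `1`. -/
theorem det_taylor_coeff_eq_dwbc {F : Type*} [Field F] {q κ : F} (hq : q ≠ 0)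
    (hκ : q * κ = (1 - q ^ 2) ^ 2) {n : ℕ} (y c : Fin n → F) (f : Fin n → F[X])
    (hf : ∀ j, X * f j = C (c j) * ikEntry (C q) (C q⁻¹) (fun r => C (y r)) X j) :
    q ^ n.choose 2 * (Matrix.of fun i j : Fin n => (taylor 1 (f j)).coeff i).det =
      (∏ j, c j) * (q⁻¹ - q) ^ n * dwbc q κ y (List.ofFn fun _ : Fin n => 1) := by
  -- The column parameters are first taken as indeterminates: the genericity conditions then hold
  -- and the Vandermonde can be cancelled, which is impossible at equal points.
  let ι : F →+* MvPolynomial (Fin n) F := MvPolynomial.C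
  let x : Fin n → MvPolynomial (Fin n) F := MvPolynomial.X
  have hqR : ι q * ι q⁻¹ = 1 := by rw [← map_mul, mul_inv_cancel₀ hq, map_one]
  have hκR : ι q * ι κ = (1 - ι q ^ 2) ^ 2 := by
    rw [← map_mul, hκ]; simp
  have hx : ∀ i j, i ≠ j → x i - ι q ^ 2 * x j ≠ 0 := fun i j hij h => by
    have := congrArg (MvPolynomial.eval (Pi.single i (1 : F))) h
    simp [x, ι, hij.symm] at this
  have hinj : Function.Injective x := MvPolynomial.X_injective
  have main := ikDet_eq_dwbc hqR hκR (fun r => ι (y r)) x hinj hx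
  have hV : (Matrix.vandermonde x).det ≠ 0 := Matrix.det_vandermonde_ne_zero_iff.2 hinj
  have hX : ∏ i, x i ≠ 0 := Finset.prod_ne_zero_iff.2 fun i _ => MvPolynomial.X_ne_zero i
  -- By `hf`, scaling row `i` on the left by `x i` amounts to scaling column `j` of the Lascoux
  -- matrix by `c j`.
  have hdet : (∏ i, x i) * (Matrix.of fun i j => ((f j).map ι).eval (x i)).det =
      (∏ j, ι (c j)) * ikDet (ι q) (ι q⁻¹) (fun r => ι (y r)) x := by
    rw [ikDet, ← Matrix.det_mul_column, ← Matrix.det_mul_row]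
    congr 1
    ext1 i j
    have := congrArg (eval₂RingHom ι (x i)) (hf j)
    rw [map_mul, map_mul, map_ikEntry] at this
    simpa [eval_map] using this
  rw [det_eval_eq_vandermonde_mul] at hdet
  have key : ι q ^ n.choose 2 * (Matrix.of fun k j => dividedDiff n x ((f j).map ι) k).det =
      (∏ j, ι (c j)) * (ι q⁻¹ - ι q) ^ n *
        dwbc (ι q) (ι κ) (fun r => ι (y r)) (List.ofFn x) := by
    refine mul_left_cancel₀ (mul_ne_zero hX hV) ?_
    linear_combination ι q ^ n.choose 2 * hdet + (∏ j, ι (c j)) * main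
  -- The Vandermonde is gone, so all indeterminates may now be set to `1`.
  let φ : MvPolynomial (Fin n) F →+* F := MvPolynomial.eval fun _ => 1
  have hφ : ∀ a, φ (ι a) = a := fun a => MvPolynomial.eval_C a
  have hφι : φ.comp ι = RingHom.id F := RingHom.ext hφ
  have hφx : ∀ i, φ (x i) = 1 := fun i => MvPolynomial.eval_X i
  have := congrArg φ key
  rw [map_mul, map_mul, map_mul, map_dwbc, RingHom.map_det] at this
  simp only [map_pow, map_prod, map_sub, hφ, List.map_ofFn, Function.comp_def, hφx] at this
  rw [← this]
  congr 2
  ext i j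
  simp [map_dividedDiff, hφx, Polynomial.map_map, hφι, dividedDiff_const]

/-! ### The matrix `K` as a matrix of Taylor coefficients -/

theorem intBinom_natCast (a b : ℕ) : intBinom a b = a.choose b := by
  simp [intBinom, Ring.choose_natCast]

theorem intBinom_of_neg (a : ℤ) {b : ℤ} (hb : b < 0) : intBinom a b = 0 := by
  rw [intBinom, if_neg (not_le.2 hb)]

theorem intBinom_natCast_of_lt (a : ℕ) {b : ℤ} (hb : (a : ℤ) < b) : intBinom a b = 0 := by
  lift b to ℕ using by omega
  rw [intBinom_natCast, Nat.choose_eq_zero_of_lt (by omega), Nat.cast_zero]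

open Polynomial in
theorem coeff_X_add_one_pow_mul_X_pow {F : Type*} [Field F] (N d m : ℕ) :
    ((X + 1 : F[X]) ^ N * X ^ d).coeff m = (intBinom N ((m : ℤ) - d) : F) := by
  rw [coeff_mul_X_pow']
  split_ifs with h
  · rw [← Nat.cast_sub h, intBinom_natCast, coeff_X_add_one_pow, Int.cast_natCast]
  · rw [intBinom_of_neg _ (by omega), Int.cast_zero]

open Polynomial in
/-- The polynomial whose roots are the negatives of the row parameters. -/
noncomputable def rowPoly {F : Type*} [Field F] (n : ℕ) (a b : F) : F[X] :=
  (X + 1) ^ (n - 2) * (X + C a) * (X + C b)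

open Polynomial in
theorem coeff_rowPoly {F : Type*} [Field F] {n : ℕ} (hn : 2 ≤ n) (a b : F) (m : ℕ) :
    (rowPoly n a b).coeff m = (intBinom ((n : ℤ) - 2) ((m : ℤ) - 2) : F) +
      (a + b) * (intBinom ((n : ℤ) - 2) ((m : ℤ) - 1) : F) +
      a * b * (intBinom ((n : ℤ) - 2) m : F) := by
  have h : rowPoly n a b = (X + 1) ^ (n - 2) * X ^ 2 + C (a + b) * ((X + 1) ^ (n - 2) * X ^ 1) +
      C (a * b) * ((X + 1) ^ (n - 2) * X ^ 0) := by
    rw [rowPoly, C_add, C_mul]; ring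
  rw [h, coeff_add, coeff_add, coeff_C_mul, coeff_C_mul, coeff_X_add_one_pow_mul_X_pow,
    coeff_X_add_one_pow_mul_X_pow, coeff_X_add_one_pow_mul_X_pow, Nat.cast_sub hn]
  simp

open Polynomial in
theorem natDegree_rowPoly_le {F : Type*} [Field F] {n : ℕ} (hn : 2 ≤ n) (a b : F) :
    (rowPoly n a b).natDegree ≤ n := by
  obtain ⟨m, rfl⟩ := Nat.exists_eq_add_of_le' hn
  rw [rowPoly, Nat.add_sub_cancel]
  refine natDegree_mul_le.trans (add_le_add (natDegree_mul_le.trans (add_le_add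
    natDegree_pow_le le_rfl)) le_rfl) |>.trans ?_
  have h1 : (X + 1 : F[X]).natDegree ≤ 1 := by compute_degree
  have h2 : ∀ c : F, (X + C c).natDegree ≤ 1 := fun c => by compute_degree
  have := Nat.mul_le_mul_left m h1
  have := h2 a
  have := h2 b
  omega

/-- The row parameters: `a` in the first row, `b` in the last row, and `1` otherwise. -/
def rowParam {F : Type*} [Field F] (n : ℕ) (a b : F) (r : Fin n) : F :=
  if (r : ℕ) = 0 then a else if (r : ℕ) + 1 = n then b else 1

theorem prod_first_last_ite {M : Type*} [CommMonoid M] {n : ℕ} (hn : 2 ≤ n) (a b c : M) :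
    (∏ r : Fin n, if (r : ℕ) = 0 then a else if (r : ℕ) + 1 = n then b else c) =
      c ^ (n - 2) * a * b := by
  obtain ⟨m, rfl⟩ := Nat.exists_eq_add_of_le' hn
  rw [Fin.prod_univ_succ, Fin.prod_univ_castSucc, Finset.prod_congr rfl (g := fun _ => c)]
  · simp [mul_comm, mul_left_comm]
  · intro i _
    have := i.2
    simp [this.ne]

theorem prod_rowParam {F M : Type*} [Field F] [CommMonoid M] {n : ℕ} (hn : 2 ≤ n) (a b : F)
    (g : F → M) : ∏ r, g (rowParam n a b r) = g 1 ^ (n - 2) * g a * g b := by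
  rw [← prod_first_last_ite hn]
  refine Finset.prod_congr rfl fun r _ => ?_
  rw [rowParam]
  split_ifs <;> rfl

/-- The entries of `K` without the binomial coefficient that depends on the row. -/
noncomputable def kCoeff {F : Type*} [Field F] (n : ℕ) (q a b : F) (j m : ℕ) : F :=
  (-1) ^ (m + j + 1) * ((q ^ ((m : ℤ) - j) - q ^ ((j : ℤ) - m)) / (q - q⁻¹)) *
    (rowPoly n a b).coeff m

open Polynomial in
/-- The polynomial in the column parameter whose Taylor coefficients at `1` form a column
of `K`. -/
noncomputable def kPoly {F : Type*} [Field F] (n : ℕ) (q a b : F) (j : ℕ) : F[X] :=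
  ∑ m ∈ Finset.range (n + 1), C (kCoeff n q a b j m) * X ^ (j + m - 1)

open Polynomial in
theorem coeff_taylor_kPoly {F : Type*} [Field F] (n : ℕ) (q a b : F) (i j : ℕ) :
    (taylor 1 (kPoly n q a b j)).coeff i =
      ∑ m ∈ Finset.range (n + 1), kCoeff n q a b j m * ((j + m - 1).choose i : F) := by
  rw [kPoly, map_sum, finsetSum_coeff]
  refine Finset.sum_congr rfl fun m _ => ?_
  rw [taylor_mul, taylor_C, taylor_pow, taylor_X, coeff_C_mul, C_1, coeff_X_add_one_pow]

theorem kEntry_eq_sum {F : Type*} [Field F] {n : ℕ} (hn : 2 ≤ n) (q ρ τ : F) (i j : ℕ)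
    (hj : j < n) :
    kEntry n q ρ τ (i + 1) (j + 1) = ∑ m ∈ Finset.range (n + 1),
      kCoeff n q ((ρ + q) / (1 + ρ * q)) ((1 + τ * q) / (τ + q)) j m *
        ((j + m - 1).choose i : F) := by
  set a := (ρ + q) / (1 + ρ * q)
  set b := (1 + τ * q) / (τ + q)
  have hab : ((ρ + q) * (1 + τ * q)) / ((1 + ρ * q) * (τ + q)) = a * b := mul_div_mul_comm _ _ _ _
  rw [kEntry, hab]
  symm
  -- Here `j` counts from zero and `k = m - j`, so that `2 (j + 1) + k - 3 = j + m - 1`.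
  refine Finset.sum_of_injOn (fun m : ℕ => (m : ℤ) - j) ?_ ?_ ?_ ?_
  · intro m _ m' _ h
    simpa using h
  · intro m hm
    simp only [Finset.coe_range, Set.mem_Iio, Finset.coe_Icc, Set.mem_Icc] at hm ⊢
    omega
  · intro k hk hk'
    simp only [Finset.coe_range, Set.mem_image, Set.mem_Iio, not_exists, not_and] at hk'
    -- The remaining `k` have `k + j` below `0` or above `n`, where all three binomials of the
    -- bracket vanish.
    have hz : ∀ d : ℤ, 0 ≤ d → d ≤ 2 → intBinom ((n : ℤ) - 2) (k + j - d) = 0 := by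
      intro d hd hd2
      rcases lt_or_ge (k + j) 0 with h | h
      · exact intBinom_of_neg _ (by omega)
      · have : (n : ℤ) < k + j := by
          by_contra hc
          exact hk' (k + j).toNat (by omega) (by omega)
        have h2 := intBinom_natCast_of_lt (n - 2) (b := k + j - d) (by omega)
        rwa [Nat.cast_sub hn] at h2
    have h0 := hz 0 le_rfl (by norm_num)
    have h1 := hz 1 (by norm_num) (by norm_num)
    have h2 := hz 2 (by norm_num) (by norm_num)
    rw [show k + ((j : ℤ) + 1) - 3 = k + j - 2 by ring,
      show k + ((j : ℤ) + 1) - 2 = k + j - 1 by ring,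
      show k + ((j : ℤ) + 1) - 1 = k + j - 0 by ring, h0, h1, h2]
    simp
  · intro m hm
    rw [kCoeff, coeff_rowPoly hn, show (m : ℤ) - j + ((j : ℤ) + 1) - 3 = (m : ℤ) - 2 by ring,
      show (m : ℤ) - j + ((j : ℤ) + 1) - 2 = (m : ℤ) - 1 by ring,
      show (m : ℤ) - j + ((j : ℤ) + 1) - 1 = (m : ℤ) by ring, neg_sub,
      show (-1 : F) ^ ((m : ℤ) - j + 1) = (-1) ^ (m + j + 1) by
        rw [← zpow_natCast, show (((m + j + 1 : ℕ) : ℤ)) = ((m : ℤ) - j + 1) + 2 * j by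
          push_cast; ring, zpow_add₀ (by simp) ((m : ℤ) - j + 1), zpow_mul (-1 : F) 2]
        simp]
    -- For `j = m = 0` the truncated `j + m - 1` differs from the integer `-1`, but then `k = 0` and
    -- the factor `q ^ k - q ^ (-k)` vanishes.
    rcases Nat.eq_zero_or_pos (j + m) with h | h
    · obtain ⟨rfl, rfl⟩ : j = 0 ∧ m = 0 := by omega
      simp
    · have h2 : intBinom (2 * ((j : ℤ) + 1) + (m - j) - 3) ((i : ℤ) + 1 - 1) =
          ((j + m - 1).choose i : ℕ) := by
        rw [← intBinom_natCast]
        congr 1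
        · omega
        · ring
      rw [h2, Int.cast_natCast]
      ring

-- The product of `y r - u X` is `rowPoly` evaluated at `-u X`. Subtracting the expansions for `u =
-- q` and `u = q⁻¹` produces the factor `q ^ (m - j) - q ^ (j - m)`. It vanishes for `j = m = 0`,
-- which is why the entry is divisible by `X`.
open Polynomial in
theorem X_mul_kPoly {F : Type*} [Field F] {n : ℕ} (hn : 2 ≤ n) {q : F} (hq : q ≠ 0) (a b : F)
    (j : ℕ) :
    X * kPoly n q a b j = C ((-1) ^ (j + 1) / (q - q⁻¹)) *
      ikEntry (C q) (C q⁻¹) (fun r => C (rowParam n a b r)) X j := by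
  have hprod : ∀ u : F, ∏ r, (C (rowParam n a b r) - C u * X) =
      ∑ m ∈ Finset.range (n + 1), C ((rowPoly n a b).coeff m * (-u) ^ m) * X ^ m := by
    intro u
    have h := eval₂_eq_sum_range' (C : F →+* F[X])
      (Nat.lt_succ_of_le (natDegree_rowPoly_le hn a b)) (-(C u * X))
    have h2 : eval₂ (C : F →+* F[X]) (-(C u * X)) (rowPoly n a b) =
        ∏ r, (C (rowParam n a b r) - C u * X) := by
      rw [prod_rowParam hn a b (fun c => C c - C u * X), rowPoly]
      simp only [eval₂_mul, eval₂_pow, eval₂_add, eval₂_X, eval₂_C, eval₂_one, C_1]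
      ring
    rw [← h2, h]
    refine Finset.sum_congr rfl fun m _ => ?_
    rw [C_mul, C_pow, C_neg, mul_assoc, ← mul_pow, neg_mul]
  rw [ikEntry, hprod, hprod, kPoly, Finset.mul_sum, Finset.mul_sum, Finset.mul_sum,
    ← Finset.sum_sub_distrib, Finset.mul_sum]
  refine Finset.sum_congr rfl fun m _ => ?_
  have hpow : C (kCoeff n q a b j m) * (X * X ^ (j + m - 1)) =
      C (kCoeff n q a b j m) * X ^ (j + m) := by
    rcases Nat.eq_zero_or_pos (j + m) with h | h
    · obtain ⟨rfl, rfl⟩ : j = 0 ∧ m = 0 := by omega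
      simp [kCoeff]
    · rw [← pow_succ', Nat.sub_add_cancel h]
  rw [mul_left_comm, hpow]
  have hc : kCoeff n q a b j m = ((-1) ^ (j + 1) / (q - q⁻¹)) *
      (q⁻¹ ^ j * ((rowPoly n a b).coeff m * (-q) ^ m) -
        q ^ j * ((rowPoly n a b).coeff m * (-q⁻¹) ^ m)) := by
    rw [kCoeff, zpow_sub₀ hq, zpow_sub₀ hq, neg_pow q, neg_pow q⁻¹]
    simp only [zpow_natCast, inv_pow, div_eq_mul_inv]
    ring
  rw [hc]
  simp only [C_mul, C_sub, C_pow, mul_pow]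
  ring

theorem det_kMatrix {F : Type*} [Field F] {n : ℕ} (hn : 2 ≤ n) {q κ : F} (hq : q ≠ 0)
    (hq1 : q ≠ 1) (hqm1 : q ≠ -1) (hκ : q * κ = (1 - q ^ 2) ^ 2) (ρ τ : F) :
    q ^ n.choose 2 * (kMatrix n q ρ τ).det = (-1) ^ n.choose 2 *
      dwbc q κ (rowParam n ((ρ + q) / (1 + ρ * q)) ((1 + τ * q) / (τ + q)))
        (List.ofFn fun _ : Fin n => 1) := by
  set a := (ρ + q) / (1 + ρ * q) with ha
  set b := (1 + τ * q) / (τ + q) with hb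
  have h := det_taylor_coeff_eq_dwbc hq hκ (rowParam n a b)
    (fun j => (-1) ^ ((j : ℕ) + 1) / (q - q⁻¹)) (fun j => kPoly n q a b j)
    (fun j => X_mul_kPoly hn hq a b j)
  have hK : kMatrix n q ρ τ =
      Matrix.of fun i j : Fin n => (Polynomial.taylor 1 (kPoly n q a b j)).coeff i := by
    ext i j
    rw [Matrix.of_apply, coeff_taylor_kPoly, kMatrix, Matrix.of_apply, kEntry_eq_sum hn _ _ _ _ _ j.2]
  have hqq : q - q⁻¹ ≠ 0 := by
    intro h
    have : (q - 1) * (q + 1) = 0 := by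
      have h2 := mul_inv_cancel₀ hq
      linear_combination q * h + h2
    rcases mul_eq_zero.1 this with h | h
    · exact hq1 (sub_eq_zero.1 h)
    · exact hqm1 (eq_neg_of_add_eq_zero_left h)
  rw [hK, h]
  congr 1
  -- Each column constant times `q⁻¹ - q` is `(-1) ^ j`, and the exponents add up to `n.choose 2`.
  rw [← Fin.prod_const, ← Finset.prod_mul_distrib, Finset.prod_congr rfl
    (g := fun j : Fin n => (-1 : F) ^ (j : ℕ)) fun j _ => by
      rw [pow_succ, ← neg_sub q, div_mul_eq_mul_div, div_eq_iff hqq]; ring, Finset.prod_pow_eq_pow_sum,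
    Fin.sum_univ_eq_sum_range fun j => j, Finset.sum_range_id, Nat.choose_two_right]

/-! ### Six-vertex states and alternating sign matrices -/

/-- The entries of a product of matrices are sums over paths. -/
theorem prod_ofFn_apply {R S : Type*} [CommRing R] [Fintype S] [DecidableEq S] :
    ∀ (n : ℕ) (A : Fin n → Matrix S S R) (s t : S),
      (List.ofFn A).prod s t = ∑ p : Fin (n + 1) → S,
        if p 0 = s ∧ p (Fin.last n) = t then ∏ i : Fin n, A i (p i.castSucc) (p i.succ) else 0
  | 0, A, s, t => by
    rw [sum_fin_succ_fun]
    simp [Matrix.one_apply, ite_and]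
  | n + 1, A, s, t => by
    rw [sum_fin_succ_fun, List.ofFn_succ, List.prod_cons, Matrix.mul_apply]
    simp only [prod_ofFn_apply n, Finset.mul_sum]
    rw [Finset.sum_comm]
    symm
    rw [Finset.sum_comm]
    refine Finset.sum_congr rfl fun p _ => ?_
    rw [Finset.sum_eq_single_of_mem s (Finset.mem_univ _) fun c _ hc => by simp [hc],
      Finset.sum_eq_single_of_mem (p 0) (Finset.mem_univ _) fun c _ hc => by simp [hc.symm]]
    simp [Fin.prod_univ_succ, ← Fin.succ_last]

theorem monodromy_eq_prod {R : Type*} [CommRing R] (q κ X : R) :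
    ∀ (N : ℕ) (y : Fin N → R) (h h' : Fin N → Bool), monodromy q κ X N y h h' =
      (List.ofFn fun r => Matrix.of (vertexWeight q κ X (y r) (h r) (h' r))).prod
  | 0, _, _, _ => rfl
  | N + 1, y, h, h' => by
    rw [List.ofFn_succ, List.prod_cons, monodromy, monodromy_eq_prod]
    rfl

/-- The partition function as a sum over the states of the edges. -/
theorem dwbc_eq_sum {R : Type*} [CommRing R] (q κ : R) {N n : ℕ} (y : Fin N → R)
    (x : Fin n → R) :
    dwbc q κ y (List.ofFn x) =
      ∑ P : (Fin (n + 1) → Fin N → Bool) × (Fin n → Fin (N + 1) → Bool),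
        if (P.1 0 = (fun _ => false) ∧ P.1 (Fin.last n) = fun _ => true) ∧
            ∀ c, P.2 c 0 = false ∧ P.2 c (Fin.last N) = true then
          ∏ c, ∏ r, vertexWeight q κ (x c) (y r) (P.1 c.castSucc r) (P.1 c.succ r)
            (P.2 c r.castSucc) (P.2 c r.succ)
        else 0 := by
  rw [dwbc, latticeOp, List.map_ofFn, prod_ofFn_apply, Fintype.sum_prod_type]
  refine Finset.sum_congr rfl fun p _ => ?_
  simp only [ite_and, Finset.sum_ite_irrel, Finset.sum_const_zero]
  split_ifs
  · simp only [Function.comp_apply, columnOp, Matrix.of_apply, monodromy_eq_prod, prod_ofFn_apply]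
    rw [Finset.prod_univ_sum, Fintype.piFinset_univ]
    refine Finset.sum_congr rfl fun u _ => ?_
    split_ifs with h
    · exact Finset.prod_congr rfl fun c _ => if_pos (h c)
    · obtain ⟨c, hc⟩ := not_forall.1 h
      exact Finset.prod_eq_zero (Finset.mem_univ c) (if_neg hc)
  all_goals rfl

/-- The sign of the step between two states. -/
def edgeDiff : Bool → Bool → SignType
  | false, true => 1
  | true, false => -1
  | false, false => 0
  | true, true => 0

/-- The path of the partial sums of a sequence of signs. -/
noncomputable def signPath {n : ℕ} (v : Fin n → SignType) (k : Fin (n + 1)) : Bool :=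
  open Classical in
  decide (∃ j : Fin n, j.castSucc < k ∧ v j = 1 ∧ ∀ l, j < l → l.castSucc < k → v l = 0)

theorem signPath_eq_true {n : ℕ} {v : Fin n → SignType} {k : Fin (n + 1)} :
    signPath v k = true ↔
      ∃ j : Fin n, j.castSucc < k ∧ v j = 1 ∧ ∀ l, j < l → l.castSucc < k → v l = 0 := by
  simp [signPath]

theorem signPath_zero {n : ℕ} (v : Fin n → SignType) : signPath v 0 = false := by
  simp [signPath]

theorem IsAlternatingSign.signPath_last {n : ℕ} {v : Fin n → SignType}
    (hv : IsAlternatingSign v) : signPath v (Fin.last n) = true := by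
  obtain ⟨j, hj, hl⟩ := hv.last_eq_one
  exact signPath_eq_true.2 ⟨j, Fin.castSucc_lt_last j, hj, fun l h _ => hl l h⟩

/-- The path is `true` when the last nonzero sign passed is `1`. Alternation lets a `1` follow only
the state `false` and a `-1` only `true`. -/
theorem IsAlternatingSign.edgeDiff_signPath {n : ℕ} {v : Fin n → SignType}
    (hv : IsAlternatingSign v) (i : Fin n) :
    edgeDiff (signPath v i.castSucc) (signPath v i.succ) = v i := by
  have hlt : ∀ l : Fin n, l.castSucc < i.succ ↔ l = i ∨ l.castSucc < i.castSucc := by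
    intro l
    simp only [Fin.lt_def, Fin.ext_iff, Fin.val_castSucc, Fin.val_succ]
    omega
  rcases SignType.trichotomy (v i) with h | h | h
  · have h1 : signPath v i.succ = false := by
      rw [← Bool.not_eq_true, signPath_eq_true]
      rintro ⟨j, hj, hj1, hj2⟩
      rcases (hlt j).1 hj with rfl | hji
      · rw [hj1] at h; exact absurd h (by decide)
      · have := hj2 i (by simpa using hji) ((hlt i).2 (Or.inl rfl))
        rw [this] at h; exact absurd h (by decide)
    have h2 : signPath v i.castSucc = true := by
      obtain ⟨j0, hj0, hz⟩ := hv.first_eq_one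
      have hlt0 : j0 < i := by
        rcases lt_trichotomy j0 i with h' | h' | h'
        · exact h'
        · rw [h', h] at hj0; exact absurd hj0 (by decide)
        · rw [hz i h'] at h; exact absurd h (by decide)
      -- The last nonzero sign before the `-1` exists because the first nonzero sign is a `1`; by
      -- alternation it is `1`.
      let s := Finset.univ.filter fun l : Fin n => l < i ∧ v l ≠ 0
      have hs : s.Nonempty := ⟨j0, by simp [s, hlt0, hj0]⟩
      have hm := s.max'_mem hs
      set m := s.max' hs
      simp only [s, Finset.mem_filter, Finset.mem_univ, true_and] at hm
      have hzero : ∀ k, m < k → k < i → v k = 0 := by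
        intro k hk hki
        by_contra hne
        exact absurd (s.le_max' k (by simp [s, hki, hne])) (not_le.2 hk)
      have halt := hv.alternate m i hm.1 hm.2 (by rw [h]; decide) hzero
      refine signPath_eq_true.2 ⟨m, by simpa using hm.1, ?_, fun l hl hli =>
        hzero l hl (by simpa using hli)⟩
      rw [h] at halt
      rw [← neg_neg (v m), ← halt]; rfl
    rw [h1, h2, h]; rfl
  · have : signPath v i.succ = signPath v i.castSucc := by
      rw [Bool.eq_iff_iff, signPath_eq_true, signPath_eq_true]
      constructor
      · rintro ⟨j, hj, hj1, hj2⟩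
        rcases (hlt j).1 hj with rfl | hji
        · rw [hj1] at h; exact absurd h (by decide)
        · exact ⟨j, hji, hj1, fun l hl hli => hj2 l hl ((hlt l).2 (Or.inr hli))⟩
      · rintro ⟨j, hj, hj1, hj2⟩
        refine ⟨j, (hlt j).2 (Or.inr hj), hj1, fun l hl hli => ?_⟩
        rcases (hlt l).1 hli with rfl | hli
        · exact h
        · exact hj2 l hl hli
    rw [this, h]
    cases signPath v i.castSucc <;> rfl
  · have h1 : signPath v i.succ = true :=
      signPath_eq_true.2 ⟨i, (hlt i).2 (Or.inl rfl), h, fun l hl hli => by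
        rcases (hlt l).1 hli with rfl | hli
        · exact absurd hl (lt_irrefl _)
        · exact absurd hl (not_lt.2 (by simpa using hli.le))⟩
    have h2 : signPath v i.castSucc = false := by
      rw [← Bool.not_eq_true, signPath_eq_true]
      rintro ⟨j, hj, hj1, hj2⟩
      have := hv.alternate j i (by simpa using hj) (by rw [hj1]; decide) (by rw [h]; decide)
        fun k hk hki => hj2 k hk (by simpa using hki)
      rw [h, hj1] at this
      exact absurd this (by decide)
    rw [h1, h2, h]; rfl

theorem eq_of_edgeDiff_eq {n : ℕ} {p p' : Fin (n + 1) → Bool} (h0 : p 0 = p' 0)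
    (h : ∀ i : Fin n, edgeDiff (p i.castSucc) (p i.succ) = edgeDiff (p' i.castSucc) (p' i.succ)) :
    p = p' := by
  ext1 k
  induction k using Fin.induction with
  | zero => exact h0
  | succ i ih =>
    have := h i
    rw [ih] at this
    revert this
    cases p' i.castSucc <;> cases p i.succ <;> cases p' i.succ <;> decide

/-- Rises and falls of a two-valued path alternate. Starting at `false` and ending at `true` makes
the first and the last change a rise. -/
theorem isAlternatingSign_edgeDiff {n : ℕ} {p : Fin (n + 1) → Bool} (h0 : p 0 = false)
    (h1 : p (Fin.last n) = true) :
    IsAlternatingSign fun i : Fin n => edgeDiff (p i.castSucc) (p i.succ) where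
  first_eq_one := by
    let s := Finset.univ.filter fun k => p k = true
    have hs : s.Nonempty := ⟨Fin.last n, by simp [s, h1]⟩
    have hm := s.min'_mem hs
    have hmin : ∀ k, k < s.min' hs → p k = false := by
      intro k hk
      by_contra hne
      exact absurd (s.min'_le k (by simpa [s] using hne)) (not_le.2 hk)
    simp only [s, Finset.mem_filter, Finset.mem_univ, true_and] at hm
    obtain ⟨j, hj⟩ := Fin.exists_succ_eq.2 (show s.min' hs ≠ 0 from fun e => by
      have : p 0 = true := e ▸ hm
      simp [h0] at this)
    change p (s.min' hs) = true at hm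
    rw [← hj] at hm hmin
    refine ⟨j, by simp only [hm, hmin _ Fin.castSucc_lt_succ]; rfl, fun k hk => ?_⟩
    simp only [hmin k.succ (Fin.succ_lt_succ_iff.2 hk),
      hmin k.castSucc (Fin.castSucc_lt_succ.trans (Fin.succ_lt_succ_iff.2 hk))]
    rfl
  last_eq_one := by
    let s := Finset.univ.filter fun k => p k = false
    have hs : s.Nonempty := ⟨0, by simp [s, h0]⟩
    have hm := s.max'_mem hs
    have hmax : ∀ k, s.max' hs < k → p k = true := by
      intro k hk
      by_contra hne
      exact absurd (s.le_max' k (by simpa [s] using hne)) (not_le.2 hk)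
    simp only [s, Finset.mem_filter, Finset.mem_univ, true_and] at hm
    change p (s.max' hs) = false at hm
    obtain ⟨j, hj⟩ := Fin.exists_castSucc_eq.2 (show s.max' hs ≠ Fin.last n from fun e => by
      rw [e, h1] at hm
      simp at hm)
    rw [← hj] at hm hmax
    refine ⟨j, by simp only [hm, hmax _ Fin.castSucc_lt_succ]; rfl, fun k hk => ?_⟩
    simp only [hmax k.castSucc (Fin.castSucc_lt_castSucc_iff.2 hk),
      hmax k.succ ((Fin.castSucc_lt_castSucc_iff.2 hk).trans Fin.castSucc_lt_succ)]
    rfl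
  alternate i j hij hi hj hz := by
    -- Zero steps keep the path constant, so the step at `j` starts in the state where the step at
    -- `i` ended.
    have hconst : ∀ (m : ℕ) (hm : (i : ℕ) + 1 + m ≤ j),
        p ⟨i + 1 + m, by omega⟩ = p i.succ := by
      intro m
      induction m with
      | zero => intro _; rfl
      | succ m ih =>
        intro hm
        rw [← ih (by omega)]
        have := hz ⟨i + 1 + m, by omega⟩ (by rw [Fin.lt_def]; simp only; omega)
          (by rw [Fin.lt_def]; simp only; omega)
        revert this
        simp only [Fin.castSucc_mk, Fin.succ_mk, ← add_assoc]
        cases p ⟨i + 1 + m, by omega⟩ <;> cases p ⟨i + 1 + m + 1, by omega⟩ <;> decide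
    have hlt : (i : ℕ) < j := hij
    have e := hconst (j - (i + 1)) (by omega)
    have e2 : (⟨i + 1 + (j - (i + 1)), by omega⟩ : Fin (n + 1)) = j.castSucc :=
      Fin.ext (by simp only [Fin.val_castSucc]; omega)
    rw [e2] at e
    revert hi hj
    rw [e]
    cases p i.castSucc <;> cases p i.succ <;> cases p j.succ <;> decide

/-- The ice rule: it lets the horizontal and the vertical paths define the same matrix. -/
theorem edgeDiff_eq_of_vertexWeight_ne_zero {R : Type*} [CommRing R] {q κ X y : R}
    {a b c d : Bool} (h : vertexWeight q κ X y a b c d ≠ 0) : edgeDiff a b = edgeDiff c d := by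
  revert h
  cases a <;> cases b <;> cases c <;> cases d <;> simp [vertexWeight, edgeDiff]

/-- The partition function as a sum over alternating sign matrices. -/
theorem dwbc_eq_sum_ASM {R : Type*} [CommRing R] (q κ : R) {n : ℕ} (y x : Fin n → R) :
    dwbc q κ y (List.ofFn x) = ∑ A ∈ ASM n, ∏ r, ∏ c, vertexWeight q κ (x c) (y r)
      (signPath (fun j => A r j) c.castSucc) (signPath (fun j => A r j) c.succ)
      (signPath (fun i => A i c) r.castSucc) (signPath (fun i => A i c) r.succ) := by
  rw [dwbc_eq_sum]
  symm
  have hmem : ∀ A, A ∈ ASM n ↔ IsASM A := fun A => by simp [ASM]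
  refine Finset.sum_of_injOn
    (fun A => (fun c r => signPath (fun j => A r j) c, fun c r => signPath (fun i => A i c) r))
    ?_ (fun _ _ => Finset.mem_coe.2 (Finset.mem_univ _)) ?_ ?_
  · intro A hA B hB h
    have h1 := (Prod.ext_iff.1 h).1
    ext1 r c
    rw [← (((hmem A).1 hA).row r).edgeDiff_signPath c, ← (((hmem B).1 hB).row r).edgeDiff_signPath c]
    have h2 := fun k => congrFun (congrFun h1 k) r
    simp only at h2
    rw [h2, h2]
  · rintro ⟨p, u⟩ _ hP
    by_contra hne
    obtain ⟨⟨⟨hp0, hp1⟩, hu⟩, hne⟩ := ite_ne_right_iff.1 hne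
    simp only at hp0 hp1 hu hne
    -- A nonzero term has no vanishing vertex weight, so the ice rule holds everywhere and the
    -- common steps form the required matrix.
    have hcons : ∀ c r, edgeDiff (p c.castSucc r) (p c.succ r) =
        edgeDiff (u c r.castSucc) (u c r.succ) := fun c r =>
      edgeDiff_eq_of_vertexWeight_ne_zero
        fun h => hne
        (Finset.prod_eq_zero (Finset.mem_univ c) (Finset.prod_eq_zero (Finset.mem_univ r) h))
    refine hP ⟨Matrix.of fun r c => edgeDiff (p c.castSucc r) (p c.succ r), ?_, ?_⟩
    · refine (hmem _).2 ⟨fun r => ?_, fun c => ?_⟩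
      · exact isAlternatingSign_edgeDiff (p := fun k => p k r) (congrFun hp0 r) (congrFun hp1 r)
      · simp only [Matrix.of_apply, hcons]
        exact isAlternatingSign_edgeDiff (p := u c) (hu c).1 (hu c).2
    · refine Prod.ext ?_ ?_
      · ext1 c; ext1 r
        have hr := isAlternatingSign_edgeDiff (p := fun k => p k r) (congrFun hp0 r)
          (congrFun hp1 r)
        exact congrFun (eq_of_edgeDiff_eq (p' := fun k => p k r)
          ((signPath_zero _).trans (congrFun hp0 r).symm) fun i => hr.edgeDiff_signPath i) c
      · ext1 c; ext1 r
        have hc := isAlternatingSign_edgeDiff (p := u c) (hu c).1 (hu c).2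
        simp only [Matrix.of_apply, hcons]
        exact congrFun (eq_of_edgeDiff_eq (p' := u c)
          ((signPath_zero _).trans (hu c).1.symm) fun i => hc.edgeDiff_signPath i) r
  · intro A hA
    have hA := (hmem A).1 hA
    rw [if_pos, Finset.prod_comm]
    exact ⟨⟨funext fun r => signPath_zero _, funext fun r => (hA.row r).signPath_last⟩,
      fun c => ⟨signPath_zero _, (hA.col c).signPath_last⟩⟩

/-! ### Weights of the rows of an alternating sign matrix -/

/-- A change of gauge: factors attached to interior edges cancel between neighbouring vertices, and
only the two ends of the row remain. -/
theorem prod_mul_eq_of_telescoping {F : Type*} [Field F] {n : ℕ} (w b : Fin n → F)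
    (g : Fin (n + 1) → F) (hg : ∀ k, g k ≠ 0)
    (h : ∀ c, w c * g c.succ = b c * g c.castSucc) :
    (∏ c, w c) * g (Fin.last n) = (∏ c, b c) * g 0 := by
  have h1 : (∏ c, w c) * ∏ c, g (Fin.succ c) = (∏ c, b c) * ∏ c, g (Fin.castSucc c) := by
    rw [← Finset.prod_mul_distrib, ← Finset.prod_mul_distrib]
    exact Finset.prod_congr rfl fun c _ => h c
  have h2 : g 0 * ∏ c, g (Fin.succ c) = (∏ c, g (Fin.castSucc c)) * g (Fin.last n) := by
    rw [← Fin.prod_univ_succ, Fin.prod_univ_castSucc]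
  have h3 : ∏ c, g (Fin.castSucc c) ≠ 0 := Finset.prod_ne_zero_iff.2 fun c _ => hg _
  refine mul_left_cancel₀ h3 ?_
  linear_combination g 0 * h1 - (∏ c, w c) * h2

/-- The product of the weights along a row, where a factor `k` is carried along the edges. -/
theorem prod_row_eq {F : Type*} [Field F] {n : ℕ} (hn : n ≠ 0) (w b : Fin n → F) (k : F)
    (hk : k ≠ 0) (p : Fin (n + 1) → Bool) (h0 : p 0 = false) (h1 : p (Fin.last n) = true)
    (h : ∀ c, w c * (if p c.succ then k else 1) = k * b c * (if p c.castSucc then k else 1)) :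
    ∏ c, w c = k ^ (n - 1) * ∏ c, b c := by
  have := prod_mul_eq_of_telescoping w (fun c => k * b c) (fun i => if p i then k else 1)
    (fun i => by split_ifs <;> simp [hk]) h
  simp only [h0, h1, if_true, Bool.false_eq_true, if_false, mul_one, Finset.prod_mul_distrib,
    Finset.prod_const, Finset.card_univ, Fintype.card_fin] at this
  obtain ⟨m, rfl⟩ := Nat.exists_eq_succ_of_ne_zero hn
  refine mul_right_cancel₀ hk ?_
  rw [this, Nat.succ_sub_one, pow_succ]
  ring

theorem exists_unique_step {n : ℕ} {p : Fin (n + 1) → Bool} (h0 : p 0 = false)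
    (h1 : p (Fin.last n) = true) (hmono : ∀ c : Fin n, p c.castSucc = true → p c.succ = true) :
    ∃ j : Fin n, ∀ c : Fin n, (p c.succ = false ↔ c < j) ∧ (p c.castSucc = false ↔ c ≤ j) := by
  have hm : ∀ k l : Fin (n + 1), k ≤ l → p k = true → p l = true := by
    intro k l
    induction l using Fin.induction with
    | zero => intro hkl hk; rwa [Fin.le_zero_iff.1 hkl] at hk
    | succ l ih =>
      intro hkl hk
      rcases hkl.eq_or_lt with rfl | hlt
      · exact hk
      · exact hmono l (ih (Fin.le_castSucc_iff.2 hlt) hk)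
  obtain ⟨j, hj, hz⟩ := (isAlternatingSign_edgeDiff h0 h1).first_eq_one
  have hj' : p j.castSucc = false ∧ p j.succ = true := by
    revert hj
    cases p j.castSucc <;> cases p j.succ <;> decide
  have hlow : ∀ k : Fin (n + 1), k ≤ j.castSucc → p k = false := fun k hk => by
    by_contra hne
    have := hm k _ hk (by simpa using hne)
    simp [hj'.1] at this
  have hhigh : ∀ k : Fin (n + 1), j.succ ≤ k → p k = true := fun k hk => hm _ k hk hj'.2
  refine ⟨j, fun c => ⟨⟨fun h => ?_, fun h => hlow _ ?_⟩, ⟨fun h => ?_, fun h => hlow _ ?_⟩⟩⟩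
  · by_contra hne
    have := hhigh c.succ (Fin.succ_le_succ_iff.2 (not_lt.1 hne))
    simp [h] at this
  · rw [Fin.le_def]; simpa using h
  · by_contra hne
    have := hhigh c.castSucc (by rw [Fin.le_def]; simpa using not_le.1 hne)
    simp [h] at this
  · simpa using h

theorem prod_ite_lt {F : Type*} [Field F] {n : ℕ} (j : Fin n) (a : F) :
    (∏ c : Fin n, if c < j then a else 1) = a ^ (j : ℕ) := by
  rw [Finset.prod_ite, Finset.prod_const_one, mul_one, Finset.prod_const,
    show Finset.univ.filter (fun c => c < j) = Finset.Iio j by ext; simp, Fin.card_Iio]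

theorem IsASM.edgeDiff_signPath {n : ℕ} {A : Matrix (Fin n) (Fin n) SignType}
    (hA : IsASM A) (r c : Fin n) :
    A r c = edgeDiff (signPath (fun j => A r j) c.castSucc) (signPath (fun j => A r j) c.succ) ∧
    A r c = edgeDiff (signPath (fun i => A i c) r.castSucc) (signPath (fun i => A i c) r.succ) :=
  ⟨((hA.row r).edgeDiff_signPath c).symm, ((hA.col c).edgeDiff_signPath r).symm⟩

/-- Zeros weigh `1 - q`, a `1` weighs `1`, and a `-1` weighs `(1 - q) ^ 2 * z`. Carrying `1 - q`
along the `true` edges moves one such factor from each `-1` to the preceding `1`; the last `1` stays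
without, hence the exponent `n - 1`. -/
theorem prod_interior_row {F : Type*} [Field F] {q κ z : F} (hq1 : q ≠ 1)
    (hz : κ = (1 - q) ^ 2 * z) {n : ℕ} {A : Matrix (Fin n) (Fin n) SignType} (hA : IsASM A)
    (r : Fin n) :
    (∏ c, vertexWeight q κ 1 1
      (signPath (fun j => A r j) c.castSucc) (signPath (fun j => A r j) c.succ)
      (signPath (fun i => A i c) r.castSucc) (signPath (fun i => A i c) r.succ)) =
      (1 - q) ^ (n - 1) * ∏ c, if A r c = -1 then z else 1 := by
  refine prod_row_eq (Nat.ne_zero_of_lt r.2) _ _ _ (sub_ne_zero.2 hq1.symm)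
    (signPath fun j => A r j) (signPath_zero _) (hA.row r).signPath_last fun c => ?_
  obtain ⟨h1, h2⟩ := IsASM.edgeDiff_signPath hA r c
  revert h1 h2
  generalize A r c = a
  cases signPath (fun j => A r j) c.castSucc <;> cases signPath (fun j => A r j) c.succ <;>
    cases signPath (fun i => A i c) r.castSucc <;> cases signPath (fun i => A i c) r.succ <;>
    rintro h1 h2 <;> first
      | (rw [h1] at h2; exact absurd h2 (by decide))
      | (rw [h1]; simp [vertexWeight, edgeDiff, hz]; try ring)

/-- With all upper edges `false` (or all lower edges `true`) no `-1` fits, so the row has a single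
`1`. Zeros to its left weigh `k * s`, those to its right `k`. -/
theorem prod_boundary_row {F : Type*} [Field F] {q κ k y s : F} (hk : k ≠ 0) {n : ℕ}
    {A : Matrix (Fin n) (Fin n) SignType} (hA : IsASM A) (r : Fin n) (v : Bool)
    (hv : (v = false ∧ y - q = k * s ∧ 1 - q * y = k ∧
        ∀ c, signPath (fun i => A i c) r.castSucc = false) ∨
      (v = true ∧ 1 - q * y = k * s ∧ y - q = k ∧
        ∀ c, signPath (fun i => A i c) r.succ = true)) :
    ∃ j : Fin n, (∀ c, A r c = 1 ↔ c = j) ∧ (∀ c, A r c ≠ -1) ∧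
    (∏ c, vertexWeight q κ 1 y
      (signPath (fun j => A r j) c.castSucc) (signPath (fun j => A r j) c.succ)
      (signPath (fun i => A i c) r.castSucc) (signPath (fun i => A i c) r.succ)) =
      k ^ (n - 1) * s ^ (j : ℕ) := by
  have hneg : ∀ c, A r c ≠ -1 := by
    intro c h
    obtain ⟨-, h2⟩ := IsASM.edgeDiff_signPath hA r c
    rw [h] at h2
    rcases hv with ⟨-, -, -, h3⟩ | ⟨-, -, -, h3⟩ <;> rw [h3 c] at h2 <;> revert h2
    · cases signPath (fun i => A i c) r.succ <;> decide
    · cases signPath (fun i => A i c) r.castSucc <;> decide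
  obtain ⟨j, hj⟩ := exists_unique_step (p := signPath fun j => A r j) (signPath_zero _)
    (hA.row r).signPath_last fun c hc => by
      have h1 := (IsASM.edgeDiff_signPath hA r c).1
      have h2 := hneg c
      rw [hc] at h1
      by_contra hne
      rw [Bool.not_eq_true] at hne
      rw [hne] at h1
      exact h2 h1
  refine ⟨j, fun c => ?_, hneg, ?_⟩
  · have h1 := (IsASM.edgeDiff_signPath hA r c).1
    obtain ⟨h2, h3⟩ := hj c
    rw [h1]
    rcases lt_trichotomy c j with h | h | h
    · rw [h2.2 h, h3.2 h.le]
      exact ⟨fun e => absurd e (by decide), fun e => absurd e h.ne⟩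
    · have h4 : signPath (fun j => A r j) c.succ = true := by
        by_contra hne
        exact absurd (h2.1 (by simpa using hne)) (by simp [h])
      rw [h4, h3.2 h.le]
      exact ⟨fun _ => h, fun _ => rfl⟩
    · have h4 : signPath (fun j => A r j) c.succ = true := by
        by_contra hne
        exact absurd (h2.1 (by simpa using hne)) (not_lt.2 h.le)
      have h5 : signPath (fun j => A r j) c.castSucc = true := by
        by_contra hne
        exact absurd (h3.1 (by simpa using hne)) (not_le.2 h)
      rw [h4, h5]
      exact ⟨fun e => absurd e (by decide), fun e => absurd e h.ne'⟩
  · rw [← prod_ite_lt]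
    refine prod_row_eq (Nat.ne_zero_of_lt r.2) _ _ _ hk
      (signPath fun j => A r j) (signPath_zero _) (hA.row r).signPath_last fun c => ?_
    obtain ⟨h1, h2⟩ := IsASM.edgeDiff_signPath hA r c
    simp only [← (hj c).1]
    have hn := hneg c
    rw [h1] at h2 hn
    clear h1
    rcases hv with ⟨-, e1, e2, h3⟩ | ⟨-, e1, e2, h3⟩ <;> rw [h3 c] at h2 ⊢ <;> revert h2 hn
    · cases signPath (fun j => A r j) c.castSucc <;> cases signPath (fun j => A r j) c.succ <;>
        cases signPath (fun i => A i c) r.succ <;> intro h2 hn <;>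
        first
          | exact absurd h2 (by decide)
          | exact absurd rfl hn
          | simp [vertexWeight, e1, e2]
    · cases signPath (fun j => A r j) c.castSucc <;> cases signPath (fun j => A r j) c.succ <;>
        cases signPath (fun i => A i c) r.castSucc <;> intro h2 hn <;>
        first
          | exact absurd h2 (by decide)
          | exact absurd rfl hn
          | simp [vertexWeight, e1, e2]

theorem pow_numNegOnes {F : Type*} [Field F] (z : F) {n : ℕ}
    (A : Matrix (Fin n) (Fin n) SignType) :
    z ^ numNegOnes A = ∏ r, ∏ c, if A r c = -1 then z else 1 := by
  rw [numNegOnes, ← Fintype.prod_prod_type' (f := fun r c => if A r c = -1 then z else 1),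
    Finset.prod_ite, Finset.prod_const_one, mul_one, Finset.prod_const]

/-- The weight of an alternating sign matrix when all column parameters are `1`. -/
theorem prod_vertexWeight_eq {F : Type*} [Field F] {n : ℕ} (hn : 2 ≤ n) {q κ z ρ τ : F}
    (hq1 : q ≠ 1) (hqm1 : q ≠ -1) (hz : κ = (1 - q) ^ 2 * z) (hρ : 1 + ρ * q ≠ 0)
    (hτ : τ + q ≠ 0) {A : Matrix (Fin n) (Fin n) SignType} (hA : IsASM A) :
    ρ * τ * (∏ r, ∏ c, vertexWeight q κ 1
      (rowParam n ((ρ + q) / (1 + ρ * q)) ((1 + τ * q) / (τ + q)) r)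
      (signPath (fun j => A r j) c.castSucc) (signPath (fun j => A r j) c.succ)
      (signPath (fun i => A i c) r.castSucc) (signPath (fun i => A i c) r.succ)) =
      ((1 - q ^ 2) / (1 + ρ * q) * ((1 - q ^ 2) / (τ + q)) * (1 - q) ^ (n - 2)) ^ (n - 1) *
        (z ^ numNegOnes A * ρ ^ firstRowCol A * τ ^ lastRowCol A) := by
  have h0n : 0 < n := by omega
  have hln : n - 1 < n := by omega
  have hρ' : 1 + q * ρ ≠ 0 := by rwa [mul_comm q]
  have hq2 : 1 - q ^ 2 ≠ 0 := by
    rw [show 1 - q ^ 2 = (1 - q) * (1 + q) by ring]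
    exact mul_ne_zero (sub_ne_zero.2 hq1.symm) fun h => hqm1 (eq_neg_of_add_eq_zero_right h)
  -- This `y` solves `y - q = ρ (1 - q y)`, and `k` is the resulting value of `1 - q y`.
  obtain ⟨f, hf, hf', hfw⟩ := prod_boundary_row (q := q) (κ := κ)
    (k := (1 - q ^ 2) / (1 + ρ * q)) (y := (ρ + q) / (1 + ρ * q)) (s := ρ)
    (div_ne_zero hq2 hρ) hA ⟨0, h0n⟩ false
    (Or.inl ⟨rfl, by field_simp; ring, by field_simp; ring, fun c => signPath_zero _⟩)
  -- In the last row the two weights trade places: `y` solves `1 - q y = τ (y - q)`.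
  obtain ⟨l, hl, hl', hlw⟩ := prod_boundary_row (q := q) (κ := κ)
    (k := (1 - q ^ 2) / (τ + q)) (y := (1 + τ * q) / (τ + q)) (s := τ)
    (div_ne_zero hq2 hτ) hA ⟨n - 1, hln⟩ true
    (Or.inr ⟨rfl, by field_simp; ring, by field_simp; ring, fun c => by
      rw [← (hA.col c).signPath_last]
      congr 1
      exact Fin.ext (by simp; omega)⟩)
  -- Columns are counted from one here but `f` and `l` from zero, which accounts for the prefactor
  -- `ρ * τ`.
  have hfc : firstRowCol A = f + 1 := by
    have : {c : ℕ | ∃ i j : Fin n, (i : ℕ) + 1 = 1 ∧ (j : ℕ) + 1 = c ∧ A i j = 1} =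
        {(f : ℕ) + 1} := by
      ext c
      simp only [Set.mem_ofPred_eq, Set.mem_singleton_iff]
      constructor
      · rintro ⟨i, j, hi, rfl, hij⟩
        obtain rfl : i = ⟨0, h0n⟩ := Fin.ext (by simpa using hi)
        rw [(hf j).1 hij]
      · rintro rfl
        exact ⟨_, f, rfl, rfl, (hf f).2 rfl⟩
    rw [firstRowCol, this, csInf_singleton]
  have hlc : lastRowCol A = l + 1 := by
    have : {c : ℕ | ∃ i j : Fin n, (i : ℕ) + 1 = n ∧ (j : ℕ) + 1 = c ∧ A i j = 1} =
        {(l : ℕ) + 1} := by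
      ext c
      simp only [Set.mem_ofPred_eq, Set.mem_singleton_iff]
      constructor
      · rintro ⟨i, j, hi, rfl, hij⟩
        obtain rfl : i = ⟨n - 1, hln⟩ := Fin.ext (by simp only; omega)
        rw [(hl j).1 hij]
      · rintro rfl
        exact ⟨_, l, by simp only; omega, rfl, (hl l).2 rfl⟩
    rw [lastRowCol, this, csInf_singleton]
  have hrow : ∀ r : Fin n, (∏ c, vertexWeight q κ 1
      (rowParam n ((ρ + q) / (1 + ρ * q)) ((1 + τ * q) / (τ + q)) r)
      (signPath (fun j => A r j) c.castSucc) (signPath (fun j => A r j) c.succ)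
      (signPath (fun i => A i c) r.castSucc) (signPath (fun i => A i c) r.succ)) =
      (if (r : ℕ) = 0 then ((1 - q ^ 2) / (1 + ρ * q)) ^ (n - 1) * ρ ^ (f : ℕ)
        else if (r : ℕ) + 1 = n then ((1 - q ^ 2) / (τ + q)) ^ (n - 1) * τ ^ (l : ℕ)
        else (1 - q) ^ (n - 1)) * ∏ c, if A r c = -1 then z else 1 := by
    intro r
    rw [rowParam]
    split_ifs with h1 h2
    · obtain rfl : r = ⟨0, h0n⟩ := Fin.ext h1
      rw [hfw, Finset.prod_congr rfl fun c _ => if_neg (hf' c), Finset.prod_const_one, mul_one]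
    · obtain rfl : r = ⟨n - 1, hln⟩ := Fin.ext (by simp only; omega)
      rw [hlw, Finset.prod_congr rfl fun c _ => if_neg (hl' c), Finset.prod_const_one, mul_one]
    · exact prod_interior_row hq1 hz hA r
  rw [Finset.prod_congr rfl fun r _ => hrow r, Finset.prod_mul_distrib, prod_first_last_ite hn,
    ← pow_numNegOnes, hfc, hlc, mul_pow, mul_pow, ← pow_mul, ← pow_mul, mul_comm (n - 2)]
  ring

/-! ### Collecting the constants -/

theorem theorem1p1 {F : Type*} [Field F] (n : ℕ) (hn : 2 ≤ n) (q ρ τ : F)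
    (hq : q ≠ 0) (hq1 : q ≠ 1) (hqm1 : q ≠ -1)
    (hρ : 1 + ρ * q ≠ 0) (hτ : τ + q ≠ 0) :
    asmGF n (2 + q + q⁻¹) ρ τ =
      (((1 + ρ * q) * (τ + q)) / (1 + q) ^ 2) ^ (n - 1) *
        ((τ * ρ * (kMatrix n q ρ τ).det) / (2 - q - q⁻¹) ^ (n * (n - 1) / 2)) := by
  have hρ' : 1 + q * ρ ≠ 0 := by rwa [mul_comm q]
  have hm : 1 - q ≠ 0 := sub_ne_zero.2 hq1.symm
  have hp : 1 + q ≠ 0 := fun h => hqm1 (eq_neg_of_add_eq_zero_right h)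
  -- Since `q (2 + q + q⁻¹) = (1 + q) ^ 2`, this value meets both the Yang–Baxter condition and the
  -- weight needed for each `-1`.
  set κ := (1 - q) ^ 2 * (2 + q + q⁻¹) with hκz
  have hκ : q * κ = (1 - q ^ 2) ^ 2 := by
    rw [hκz]; field_simp; ring
  have hdet := det_kMatrix hn hq hq1 hqm1 hκ ρ τ
  rw [dwbc_eq_sum_ASM] at hdet
  have hsum : ρ * τ * (q ^ n.choose 2 * (kMatrix n q ρ τ).det) = (-1) ^ n.choose 2 *
      (((1 - q ^ 2) / (1 + ρ * q) * ((1 - q ^ 2) / (τ + q)) * (1 - q) ^ (n - 2)) ^ (n - 1) *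
        asmGF n (2 + q + q⁻¹) ρ τ) := by
    rw [hdet, asmGF, mul_left_comm]
    congr 1
    rw [Finset.mul_sum, Finset.mul_sum]
    refine Finset.sum_congr rfl fun A hA => ?_
    exact prod_vertexWeight_eq hn hq1 hqm1 hκz hρ hτ (by simpa [ASM] using hA)
  -- From `q (2 - q - q⁻¹) = -(1 - q) ^ 2` and `2 * n.choose 2 = n (n - 1)`.
  have hfac : (2 - q - q⁻¹) ^ n.choose 2 * q ^ n.choose 2 =
      (-1) ^ n.choose 2 * ((1 - q) ^ n) ^ (n - 1) := by
    have : n.choose 2 * 2 = n * (n - 1) := by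
      rw [Nat.choose_two_right, Nat.div_mul_cancel (Nat.even_mul_pred_self n).two_dvd]
    rw [← pow_mul, ← this, mul_comm _ 2, pow_mul, ← mul_pow, ← mul_pow]
    congr 1
    field_simp
    ring
  have hconst : (1 - q ^ 2) / (1 + ρ * q) * ((1 - q ^ 2) / (τ + q)) * (1 - q) ^ (n - 2) *
      ((1 + ρ * q) * (τ + q) / (1 + q) ^ 2) = (1 - q) ^ n := by
    obtain ⟨m, rfl⟩ := Nat.exists_eq_add_of_le' hn
    rw [Nat.add_sub_cancel, pow_add, show 1 - q ^ 2 = (1 - q) * (1 + q) by ring]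
    field_simp
  have hne : (2 - q - q⁻¹) ^ n.choose 2 ≠ 0 := fun h => by
    rw [h, zero_mul] at hfac
    exact mul_ne_zero (pow_ne_zero _ (neg_ne_zero.2 one_ne_zero))
      (pow_ne_zero _ (pow_ne_zero _ hm)) hfac.symm
  rw [← Nat.choose_two_right, ← mul_div_assoc, eq_div_iff hne]
  have hqn : q ^ n.choose 2 ≠ 0 := pow_ne_zero _ hq
  refine mul_right_cancel₀ hqn ?_
  rw [mul_assoc, hfac, ← hconst, mul_pow]
  linear_combination (-((1 + ρ * q) * (τ + q) / (1 + q) ^ 2) ^ (n - 1)) * hsum
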